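/- **Theorem 8.** Let $q\ge 5$ be a prime power and let $N$ be a positive integer with $N\mid q^2-1$ and $N\nmid q+1$. Let $u,t\ge 1$ and $v\ge 0$ be integers with $v\le u$ and $2u+v\le q-2$, and put $(r,\delta)=(q-1-u,\,u+1)$. Then there is an optimal quantum $(r,\delta)$-LRC with parameters $$[[\,Nt(q-1),\; Nt(q-1)-2Ntu-2v,\; u+v+1\,]]_q ,$$ so that, with $t$ ranging over the positive integers, one obtains an infinite family. More precisely, there are a permutation $\tau$ of $\{1,\dots,N\}$, a type II $\tau$-OD matrix $A\in\mathbb F_{q^2}^{N\times N}$ and linear codes $\mathcal C_1,\dots,\mathcal C_N\subseteq\mathbb F_{q^2}^{t(q-1)}$ such that the matrix-product code $[\mathcal C_1,\dots,\mathcal C_N]\cdot A$ is Hermitian dual-containing and induces such a quantum code. Here the following terminology is used. * A matrix $A\in\mathbb F_{q^2}^{N\times N}$ is *type II $\tau$-OD* if (i) for every $1\le s\le N$, every $s\times s$ submatrix formed by the first $s$ rows of $A$ and some $s$ columns is invertible, and (ii) the nonzero entries of $AA^{\dagger}$, where $A^\dagger=(a_{j,i}^q)$, are exactly those in the positions $(i,\tau(i))$,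 $1\le i\le N$. * The matrix-product code $[\mathcal C_1,\dots,\mathcal C_N]\cdot A$ is the set of all words $\big(\sum_i a_{i,1}\mathbf c_i,\dots,\sum_i a_{i,N}\mathbf c_i\big)$ with $\mathbf c_i\in\mathcal C_i$. * The Hermitian dual of a linear code $\mathcal C\subseteq\mathbb F_{q^2}^n$ is $\mathcal C^{\perp_{\mathrm H}}=\{\mathbf x:\sum_i x_iy_i^q=0\text{ for all }\mathbf y\in\mathcal C\}$, and $\mathcal C$ is Hermitian dual-containing if $\mathcal C^{\perp_{\mathrm H}}\subseteq\mathcal C$. Then $\mathcal C$ induces, by the usual stabilizer construction, quantum codes in $(\mathbb C^q)^{\otimes n}$: nonzero joint eigenspaces of the commuting error operators $X(\mathbf a)Z(\mathbf b)$, $\mathbf a,\mathbf b\in\mathbb F_q^n$, with $\beta\mathbf a+\beta^q\mathbf b\in\mathcal C^{\perp_{\mathrm H}}$, where $\{\beta,\beta^q\}$ is a basis of $\mathbb F_{q^2}$ over $\mathbb F_q$. * A quantum code has parameters $[[n,k,d]]_q$ if it is a $q^k$-dimensional subspace of $(\mathbb C^q)^{\otimes n}$ with minimum distance $d$, that is,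 it detects all errors $X(\mathbf a)Z(\mathbf b)$ of weight less than $d$ but not all those of weight $d$. * A linear code of length $n$ is an $(r,\delta)$-LRC if every coordinate lies in a set $S\subseteq\{1,\dots,n\}$ with $|S|\le r+\delta-1$ such that the restriction of the code to the coordinates in $S$ has minimum distance at least $\delta$. * A quantum code induced by a Hermitian dual-containing linear code $\mathcal C\subseteq\mathbb F_{q^2}^n$ is an *optimal quantum $(r,\delta)$-LRC* with parameters $[[n,k,d]]_q$ if it has these parameters, $\dim\mathcal C=\frac{n+k}2$, $d(\mathcal C)=d$, $\mathcal C$ is an $(r,\delta)$-LRC, $\delta\le d(\mathcal C^{\perp_{\mathrm H}})$, and $$k+2d+2\Big(\Big\lceil\frac{n+k}{2r}\Big\rceil-1\Big)(\delta-1)=n+2 .$$ -/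

import Mathlib

/-! ### Linear codes -/

/-- The minimum distance of a linear code, i.e. the least Hamming weight of a nonzero codeword
(`⊤` for the zero code). -/
noncomputable def minDist {F ι : Type*} [Field F] [Fintype ι] (C : Submodule F (ι → F)) : ℕ∞ :=
  ⨅ x ∈ C, ⨅ _ : x ≠ 0, (Set.ncard {i | x i ≠ 0} : ℕ∞)

/-- The Hermitian dual `{x | ∀ y ∈ C, ∑ i, x i * y i ^ q = 0}` of a code over the field with
`q ^ 2` elements. -/
def hermitianDual {L ι : Type*} [Field L] [Fintype ι] (q : ℕ) (C : Submodule L (ι → L)) :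
    Submodule L (ι → L) where
  carrier := {x | ∀ y ∈ C, ∑ i, x i * y i ^ q = 0}
  zero_mem' := by intro y _; simp
  add_mem' := by
    intro a b ha hb y hy
    simp only [Pi.add_apply, add_mul, Finset.sum_add_distrib, ha y hy, hb y hy, add_zero]
  smul_mem' := by
    intro c a ha y hy
    simp only [Pi.smul_apply, smul_eq_mul, mul_assoc, ← Finset.mul_sum, ha y hy, mul_zero]

/-- The punctured code `C|_S`: every codeword is restricted to the coordinates in `S`. -/
def puncturedCode {F ι : Type*} [Field F] (C : Submodule F (ι → F)) (S : Finset ι) :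
    Submodule F (S → F) :=
  C.map (LinearMap.funLeft F F (Subtype.val : S → ι))

/-- `C` is an `(r, δ)`-LRC: every coordinate `i` lies in a set `S` of at most `r + δ - 1`
coordinates such that the punctured code `C|_S` has minimum distance at least `δ`. -/
def IsLRC {F ι : Type*} [Field F] [Fintype ι] (r δ : ℕ) (C : Submodule F (ι → F)) : Prop :=
  ∀ i : ι, ∃ S : Finset ι, i ∈ S ∧ S.card ≤ r + δ - 1 ∧ (δ : ℕ∞) ≤ minDist (puncturedCode C S)

/-! ### Matrix-product codes and type II `τ`-OD matrices -/

/-- The matrix-product code `[C₁, …, C_N] · A`. A word of length `M * n` is the concatenation of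
its `M` blocks of length `n`; the coordinate `(j, k)` is the `k`-th coordinate of the `j`-th
block, and the `j`-th block of a codeword is `∑ i, A i j • c i` with `c i ∈ C i`. -/
def mpCode {F ι : Type*} [Field F] {N M : ℕ} (C : Fin N → Submodule F (ι → F))
    (A : Matrix (Fin N) (Fin M) F) : Submodule F (Fin M × ι → F) where
  carrier := {x | ∃ c : Fin N → ι → F, (∀ i, c i ∈ C i) ∧
    ∀ j k, x (j, k) = ∑ i, A i j * c i k}
  zero_mem' := ⟨0, fun i => (C i).zero_mem, by simp⟩
  add_mem' := by
    rintro x y ⟨c, hc, hx⟩ ⟨d, hd, hy⟩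
    refine ⟨c + d, fun i => (C i).add_mem (hc i) (hd i), fun j k => ?_⟩
    simp only [Pi.add_apply, hx, hy, mul_add, Finset.sum_add_distrib]
  smul_mem' := by
    rintro a x ⟨c, hc, hx⟩
    refine ⟨a • c, fun i => (C i).smul_mem a (hc i), fun j k => ?_⟩
    simp only [Pi.smul_apply, smul_eq_mul, hx, Finset.mul_sum]
    exact Finset.sum_congr rfl fun i _ => by ring

/-- `A` is non-singular by columns: for every `s ≤ N`, every submatrix formed by the first `s`
rows and some `s` columns `j₁ < ⋯ < j_s` is invertible. -/
def IsNSC {F : Type*} [Field F] {N M : ℕ} (A : Matrix (Fin N) (Fin M) F) : Prop :=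
  ∀ (s : ℕ) (hs : s ≤ N) (j : Fin s → Fin M), StrictMono j →
    IsUnit (A.submatrix (Fin.castLE hs) j)

/-- `B` is `τ`-monomial: its nonzero entries are exactly those in the positions `(i, τ i)`. -/
def IsMonomialFor {F : Type*} [Field F] {N : ℕ} (τ : Equiv.Perm (Fin N))
    (B : Matrix (Fin N) (Fin N) F) : Prop :=
  ∀ i j, B i j ≠ 0 ↔ j = τ i

/-- `A` is a type II `τ`-OD matrix over the field with `q ^ 2` elements: it is NSC and `A * A†` is
`τ`-monomial, where `A†` is the transpose of the matrix of the `q`-th powers of the entries. -/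
def IsTypeIITauOD {L : Type*} [Field L] {N : ℕ} (q : ℕ) (τ : Equiv.Perm (Fin N))
    (A : Matrix (Fin N) (Fin N) L) : Prop :=
  IsNSC A ∧ IsMonomialFor τ (A * (A.map (fun x => x ^ q)).transpose)

/-! ### Quantum codes

The state space `(ℂ^q)^{⊗ n} ≅ ℂ^(q ^ n)` is realised as the space of functions
`(ι → K) → ℂ`, where `K` is the field with `q` elements and `ι` has `n` elements; the function
`f` stands for the vector `∑ x, f x |x⟩`, so that the inner product is `star f ⬝ᵥ g`. -/

/-- The additive character `x ↦ exp (2 π i Tr(x) / p)` of the finite field `K` of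
characteristic `p`, where `Tr` is the trace from `K` to the prime field. -/
noncomputable def traceChar (K : Type*) [Field K] [Fintype K] : AddChar K ℂ :=
  haveI : NeZero (ringChar K) := ⟨CharP.ringChar_ne_zero_of_finite K⟩
  letI : Algebra (ZMod (ringChar K)) K := ZMod.algebra K (ringChar K)
  (ZMod.stdAddChar (N := ringChar K)).compAddMonoidHom
    (Algebra.trace (ZMod (ringChar K)) K).toAddMonoidHom

/-- The error operator `X(a) Z(b)`, which maps `|x⟩` to `ω^{Tr(b · x)} |x + a⟩`. -/
noncomputable def errorOp {K ι : Type*} [Field K] [Fintype K] [Fintype ι] (a b : ι → K) :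
    ((ι → K) → ℂ) →ₗ[ℂ] ((ι → K) → ℂ) where
  toFun f := fun y => traceChar K (∑ i, b i * (y i - a i)) * f (y - a)
  map_add' f g := by funext y; simp [mul_add]
  map_smul' c f := by funext y; simp [mul_left_comm]

/-- The weight of the error `X(a) Z(b)`: the number of positions on which it acts nontrivially. -/
noncomputable def errorWeight {K ι : Type*} [Field K] (a b : ι → K) : ℕ :=
  Set.ncard {i | a i ≠ 0 ∨ b i ≠ 0}

/-- The code `Q` detects the error `E`: compressing `E` to `Q` gives a multiple of the identity. -/
def Detects {σ : Type*} [Fintype σ] (Q : Submodule ℂ (σ → ℂ)) (E : (σ → ℂ) →ₗ[ℂ] (σ → ℂ)) :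
    Prop :=
  ∃ c : ℂ, ∀ f ∈ Q, ∀ g ∈ Q, star f ⬝ᵥ E g = c * (star f ⬝ᵥ g)

/-- `Q` is a quantum code with parameters `[[n, k, d]]_q`, where `q` is the cardinality of `K`:
it has length `n`, dimension `q ^ k` and minimum distance exactly `d`, i.e. it detects all errors
`X(a) Z(b)` of weight less than `d`, but not all those of weight `d`. -/
def IsQuantumCode {K ι : Type*} [Field K] [Fintype K] [Fintype ι] [DecidableEq ι] (n k d : ℕ)
    (Q : Submodule ℂ ((ι → K) → ℂ)) : Prop :=
  Fintype.card ι = n ∧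
  Module.finrank ℂ Q = Fintype.card K ^ k ∧
  (∀ a b : ι → K, errorWeight a b < d → Detects Q (errorOp a b)) ∧
  (∃ a b : ι → K, errorWeight a b = d ∧ ¬ Detects Q (errorOp a b))

/-- `Q` is a quantum (stabilizer) code induced by the Hermitian dual-containing code `C` over the
quadratic extension `L` of `K`, `q = |K|`: for an element `β` such that `β, β ^ q` is a basis of
`L` over `K`, it is a nonzero joint eigenspace of the (commuting) operators `X(a) Z(b)` for which
`β a + β ^ q b` belongs to the Hermitian dual of `C`. The phases `μ a b` are the eigenvalues, so
that `Q` is the space fixed by the stabilizer group formed by the operators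
`(μ a b)⁻¹ X(a) Z(b)`. -/
def IsInducedBy {K L ι : Type*} [Field K] [Fintype K] [Field L] [Algebra K L] [Fintype ι]
    (C : Submodule L (ι → L)) (Q : Submodule ℂ ((ι → K) → ℂ)) : Prop :=
  Q ≠ ⊥ ∧
  ∃ β : L, LinearIndependent K ![β, β ^ Fintype.card K] ∧
  ∃ μ : (ι → K) → (ι → K) → ℂ, ∀ f : (ι → K) → ℂ, f ∈ Q ↔
    ∀ a b : ι → K,
      (fun i => a i • β + b i • β ^ Fintype.card K) ∈ hermitianDual (Fintype.card K) C →
      errorOp a b f = μ a b • f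

/-- The quantum code `Q`, induced by the linear code `C` over the quadratic extension `L` of the
field `K` with `q` elements, is an optimal quantum `(r, δ)`-LRC with parameters `[[n, k, d]]_q`:
`C` is Hermitian dual-containing of dimension `(n + k) / 2` and minimum distance `d`, it is an
`(r, δ)`-LRC with `δ ≤ d(C^⊥H)`, the equality
`k + 2 d + 2 (⌈(n + k) / (2 r)⌉ - 1) (δ - 1) = n + 2` holds, and `Q` is an induced quantum code
with parameters `[[n, k, d]]_q`. -/
structure IsOptimalQuantumLRC {K L ι : Type*} [Field K] [Fintype K] [Field L] [Algebra K L]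
    [Fintype ι] [DecidableEq ι] (r δ n k d : ℕ) (C : Submodule L (ι → L)) (Q : Submodule ℂ ((ι → K) → ℂ)) :
    Prop where
  dual_le : hermitianDual (Fintype.card K) C ≤ C
  two_mul_finrank : 2 * Module.finrank L C = n + k
  minDist_eq : minDist C = d
  isLRC : IsLRC r δ C
  le_minDist_dual : (δ : ℕ∞) ≤ minDist (hermitianDual (Fintype.card K) C)
  optimal : (k : ℤ) + 2 * d + 2 * (⌈((n + k : ℚ) / (2 * r))⌉ - 1) * ((δ : ℤ) - 1) = n + 2
  isInducedBy : IsInducedBy C Q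
  isQuantumCode : IsQuantumCode n k d Q

/-!
The code is described by its parity checks. Its coordinates fall into `N t` groups, each a copy of
the multiplicative group `Kˣ`. Every group carries the Reed–Solomon checks `y ^ i`, `1 ≤ i ≤ u`, and
there are `v` further checks `y ^ i`, `u < i ≤ u + v`, which extend over all groups, scaled on the
block `j` by `ω ^ (-j)` for a primitive `N`-th root of unity `ω` (`groupedCode`).

* A codeword that lives in one group satisfies `u + v` consecutive Reed–Solomon checks, and one that
  meets two groups has weight at least `2 (u + 1)`; as `v ≤ u`, the minimum distance is `u + v + 1`
  (`minDist_groupedCode`). The groups are the recovery sets (`isLRC_groupedCode`).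
* The Hermitian dual consists, on each group, of the values of polynomials of degree at most `u + v`
  without constant term (`hermitianDual_groupedCode`), which gives its dimension and a bound for its
  distance. The power sums of `Kˣ` of exponents between `1` and `q - 2` vanish, and `2 u + v ≤ q - 2`,
  so that any two checks are Hermitian orthogonal except possibly two global ones; those are
  orthogonal since `∑ j, ω ^ (-j (q + 1)) = 0`, which is where `N ∤ q + 1` enters
  (`range_dualEncoder_le`).
* This code is the matrix-product code for the Vandermonde matrix with rows `(ω ^ (m j))_j`,
  `m = 2, …, N + 1`, where the constituents of all rows but the last have the checks on single groups
  only (`mpCode_rootMatrix`). Orthogonality of the characters of `ℤ/N` shows that the matrix is of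
  type II (`exists_isMonomialFor_rootMatrix`).

The quantum code is obtained from the stabilizer formalism, which is developed from the definition of
the error operators (`exists_quantumCode`). A common eigenvector of the commuting stabilizers exists,
and the trace of the projection onto its joint eigenspace gives the dimension. Errors that do not
commute with some stabilizer are detected, and errors that commute with all of them correspond to
words of `C`; outside the dual of `C` they go undetected, by a trace argument. The distance is
attained because a codeword of weight `u + v + 1` in a single group does not lie in the dual
(`exists_mem_not_mem_dual`).
-/

/-! ### Error operators -/

theorem exists_traceChar_mul_ne_one {K : Type*} [Field K] [Fintype K] {z : K} (hz : z ≠ 0) :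
    ∃ c : K, traceChar K (c * z) ≠ 1 := by
  have : NeZero (ringChar K) := ⟨CharP.ringChar_ne_zero_of_finite K⟩
  let : Algebra (ZMod (ringChar K)) K := ZMod.algebra K (ringChar K)
  obtain ⟨c, hc⟩ := FiniteField.trace_to_zmod_nondegenerate K hz
  refine ⟨c, fun h => hc ?_⟩
  rw [mul_comm] at h
  refine ZMod.injective_stdAddChar (N := ringChar K) ?_
  rw [AddChar.map_zero_eq_one]
  exact h

section ErrorOp

variable {K ι : Type*} [Field K] [Fintype K] [Fintype ι]

theorem errorOp_apply (a b : ι → K) (f : (ι → K) → ℂ) (y : ι → K) :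
    errorOp a b f y = traceChar K (b ⬝ᵥ (y - a)) * f (y - a) := rfl

theorem errorOp_errorOp (a b a' b' : ι → K) (f : (ι → K) → ℂ) :
    errorOp a b (errorOp a' b' f) =
      traceChar K (b ⬝ᵥ a') • errorOp (a + a') (b + b') f := by
  funext y
  simp only [errorOp_apply, Pi.smul_apply, smul_eq_mul]
  rw [← mul_assoc, ← mul_assoc, ← AddChar.map_add_eq_mul, ← AddChar.map_add_eq_mul, sub_sub]
  congr 2
  simp only [add_dotProduct, dotProduct_sub, dotProduct_add]
  ring

theorem errorOp_zero : errorOp (0 : ι → K) (0 : ι → K) = LinearMap.id := by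
  ext1 f
  ext y
  simp [errorOp_apply]

theorem star_errorOp_dotProduct (a b : ι → K) (f g : (ι → K) → ℂ) [DecidableEq ι] :
    star (errorOp a b f) ⬝ᵥ errorOp a b g = star f ⬝ᵥ g := by
  simp only [dotProduct, Pi.star_apply, errorOp_apply]
  rw [← Equiv.sum_comp (Equiv.addRight a)]
  refine Finset.sum_congr rfl fun y _ => ?_
  have h : star (traceChar K (b ⬝ᵥ y)) * traceChar K (b ⬝ᵥ y) = 1 := by
    rw [Complex.star_def, ← AddChar.map_neg_eq_conj, ← AddChar.map_add_eq_mul, neg_add_cancel,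
      AddChar.map_zero_eq_one]
  simp only [dotProduct] at h
  simp only [Equiv.coe_addRight, add_sub_cancel_right, star_mul']
  linear_combination (star (f y) * g y) * h

theorem errorOp_injective (a b : ι → K) : Function.Injective (errorOp a b) := by
  intro f g h
  have h2 := congrArg (errorOp (-a) (-b)) h
  simp only [errorOp_errorOp, neg_add_cancel, errorOp_zero, LinearMap.id_apply] at h2
  exact smul_right_injective _ (norm_ne_zero_iff.1 (by rw [AddChar.norm_apply]; exact one_ne_zero)) h2

open Classical in
/-- Distinct error operators are orthogonal for the trace form; this is the case of a single
operator against the identity. -/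
theorem trace_errorOp (a b : ι → K) :
    LinearMap.trace ℂ _ (errorOp a b) =
      if a = 0 ∧ b = 0 then (Fintype.card K : ℂ) ^ Fintype.card ι else 0 := by
  classical
  rw [LinearMap.trace_eq_matrix_trace ℂ (Pi.basisFun ℂ (ι → K)), Matrix.trace]
  simp only [Matrix.diag_apply, LinearMap.toMatrix_apply, Pi.basisFun_apply, Pi.basisFun_repr,
    errorOp_apply]
  by_cases ha : a = 0
  · subst ha
    simp only [sub_zero, Pi.single_eq_same, mul_one, true_and]
    by_cases hb : b = 0
    · subst hb
      simp
    · rw [if_neg hb]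
      let φ : (ι → K) →+ K :=
        { toFun := fun y => b ⬝ᵥ y, map_zero' := by simp, map_add' := dotProduct_add b }
      have hφ : (traceChar K).compAddMonoidHom φ ≠ 1 := by
        obtain ⟨i, hi⟩ := Function.ne_iff.1 hb
        obtain ⟨c, hc⟩ := exists_traceChar_mul_ne_one hi
        refine fun h => hc ?_
        have := DFunLike.congr_fun h (Pi.single i c)
        simpa [φ, mul_comm] using this
      exact AddChar.sum_eq_zero_of_ne_one hφ
  · rw [if_neg (fun h => ha h.1)]
    refine Finset.sum_eq_zero fun y _ => ?_
    rw [Pi.single_eq_of_ne, mul_zero]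
    simpa using ha

end ErrorOp

/-! ### Stabilizer codes -/

/-- A finite family of commuting endomorphisms of a nonzero finite-dimensional complex space has
a common eigenvector. -/
theorem exists_common_eigenvector {V σ : Type*} [AddCommGroup V] [Module ℂ V]
    [FiniteDimensional ℂ V] [Nontrivial V] (f : σ → Module.End ℂ V) (T : Finset σ)
    (hf : ∀ s t, Commute (f s) (f t)) :
    ∃ χ : σ → ℂ, ∃ x : V, x ≠ 0 ∧ ∀ s ∈ T, f s x = χ s • x := by
  classical
  induction T using Finset.induction_on with
  | empty =>
    obtain ⟨x, hx⟩ := exists_ne (0 : V)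
    exact ⟨0, x, hx, by simp⟩
  | insert t T ht ih =>
    obtain ⟨χ, x, hx, h⟩ := ih
    let W : Submodule ℂ V := ⨅ s ∈ T, Module.End.eigenspace (f s) (χ s)
    have hW : ∀ y, y ∈ W ↔ ∀ s ∈ T, f s y = χ s • y := by
      intro y
      simp [W, Submodule.mem_iInf]
    have hmap : ∀ y ∈ W, f t y ∈ W := by
      intro y hy
      rw [hW] at hy ⊢
      intro s hs
      have := LinearMap.congr_fun (hf s t).eq y
      simp only [Module.End.mul_apply] at this
      rw [this, hy s hs, map_smul]
    have : Nontrivial W := ⟨⟨⟨x, (hW x).2 h⟩, 0, fun hh => hx (congrArg Subtype.val hh)⟩⟩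
    obtain ⟨c, hc⟩ := Module.End.exists_eigenvalue ((f t).restrict hmap)
    obtain ⟨y, hy, hy0⟩ := hc.exists_hasEigenvector
    rw [Module.End.mem_eigenspace_iff] at hy
    have hy' : f t y = c • (y : V) := congrArg Subtype.val hy
    refine ⟨Function.update χ t c, y, fun hh => hy0 (Subtype.ext hh), fun s hsT => ?_⟩
    rcases Finset.mem_insert.1 hsT with rfl | hs
    · simpa using hy'
    · rw [Function.update_of_ne (ne_of_mem_of_not_mem hs ht)]
      exact (hW y).1 y.2 s hs

section Stabilizer

variable {K ι : Type*} [Field K] [Fintype K] [Fintype ι]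

/-- The joint eigenspace, with eigenvalues `μ`, of the operators `X(a) Z(b)` with `(a, b) ∈ S`. -/
def stabilizerSpace (S : AddSubgroup ((ι → K) × (ι → K))) (μ : (ι → K) × (ι → K) → ℂ) :
    Submodule ℂ ((ι → K) → ℂ) where
  carrier := {f | ∀ s ∈ S, errorOp s.1 s.2 f = μ s • f}
  zero_mem' := by intro s _; simp
  add_mem' := by
    intro f g hf hg s hs
    rw [map_add, hf s hs, hg s hs, smul_add]
  smul_mem' := by
    intro c f hf s hs
    rw [map_smul, hf s hs, smul_comm]

theorem mem_stabilizerSpace {S : AddSubgroup ((ι → K) × (ι → K))} {μ : (ι → K) × (ι → K) → ℂ}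
    {f : (ι → K) → ℂ} :
    f ∈ stabilizerSpace S μ ↔ ∀ s ∈ S, errorOp s.1 s.2 f = μ s • f := Iff.rfl

theorem exists_stabilizerSpace_ne_bot (S : AddSubgroup ((ι → K) × (ι → K)))
    (hS : ∀ s ∈ S, ∀ s' ∈ S, traceChar K (s.2 ⬝ᵥ s'.1) = traceChar K (s'.2 ⬝ᵥ s.1)) :
    ∃ μ, stabilizerSpace S μ ≠ ⊥ := by
  classical
  obtain ⟨χ, x, hx, h⟩ := exists_common_eigenvector
    (fun s : S => (errorOp s.1.1 s.1.2 : Module.End ℂ ((ι → K) → ℂ))) Finset.univ (by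
      intro s t
      refine LinearMap.ext fun f => ?_
      simp only [Module.End.mul_apply, errorOp_errorOp, hS s s.2 t t.2]
      rw [add_comm s.1.1, add_comm s.1.2])
  refine ⟨fun s => if hs : s ∈ S then χ ⟨s, hs⟩ else 0, fun hbot => hx ?_⟩
  rw [← Submodule.mem_bot ℂ, ← hbot, mem_stabilizerSpace]
  intro s hs
  rw [dif_pos hs]
  exact h ⟨s, hs⟩ (Finset.mem_univ _)

variable {S : AddSubgroup ((ι → K) × (ι → K))} {μ : (ι → K) × (ι → K) → ℂ}

theorem eigenvalue_ne_zero (hQ : stabilizerSpace S μ ≠ ⊥) {s : (ι → K) × (ι → K)} (hs : s ∈ S) :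
    μ s ≠ 0 := by
  obtain ⟨f, hf, hf0⟩ := Submodule.exists_mem_ne_zero_of_ne_bot hQ
  intro h
  have := hf s hs
  rw [h, zero_smul] at this
  exact hf0 (errorOp_injective s.1 s.2 (this.trans (map_zero _).symm))

theorem eigenvalue_zero (hQ : stabilizerSpace S μ ≠ ⊥) : μ 0 = 1 := by
  obtain ⟨f, hf, hf0⟩ := Submodule.exists_mem_ne_zero_of_ne_bot hQ
  have := hf 0 S.zero_mem
  rw [Prod.fst_zero, Prod.snd_zero, errorOp_zero, LinearMap.id_apply] at this
  refine smul_left_injective ℂ hf0 ?_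
  simpa using this.symm

theorem eigenvalue_mul (hQ : stabilizerSpace S μ ≠ ⊥) {s s' : (ι → K) × (ι → K)} (hs : s ∈ S)
    (hs' : s' ∈ S) : μ s * μ s' = traceChar K (s.2 ⬝ᵥ s'.1) * μ (s + s') := by
  obtain ⟨f, hf, hf0⟩ := Submodule.exists_mem_ne_zero_of_ne_bot hQ
  have h1 := errorOp_errorOp s.1 s.2 s'.1 s'.2 f
  have h2 := hf _ (S.add_mem hs hs')
  rw [Prod.fst_add, Prod.snd_add] at h2
  rw [hf s' hs', map_smul, hf s hs, h2, smul_smul, smul_smul, mul_comm] at h1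
  exact smul_left_injective ℂ hf0 h1

open Classical in
/-- The projection `|S|⁻¹ ∑ μ(s)⁻¹ E(s)` onto the joint eigenspace of the operators indexed
by `S`. -/
noncomputable def stabilizerProj (S : AddSubgroup ((ι → K) × (ι → K)))
    (μ : (ι → K) × (ι → K) → ℂ) : ((ι → K) → ℂ) →ₗ[ℂ] ((ι → K) → ℂ) :=
  (Fintype.card S : ℂ)⁻¹ • ∑ s : S, (μ s)⁻¹ • errorOp s.1.1 s.1.2

theorem stabilizerProj_isProj (hQ : stabilizerSpace S μ ≠ ⊥) :
    LinearMap.IsProj (stabilizerSpace S μ) (stabilizerProj S μ) := by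
  classical
  constructor
  · intro f s' hs'
    simp only [stabilizerProj, LinearMap.smul_apply, LinearMap.sum_apply, map_smul, map_sum,
      errorOp_errorOp]
    rw [smul_comm (μ s')]
    congr 1
    rw [Finset.smul_sum, ← Equiv.sum_comp (Equiv.addLeft (⟨s', hs'⟩ : S))
      (fun s : S => μ s' • (μ s)⁻¹ • errorOp s.1.1 s.1.2 f)]
    refine Finset.sum_congr rfl fun s _ => ?_
    rw [smul_smul, smul_smul]
    simp only [Equiv.coe_addLeft, AddSubgroup.coe_add, Prod.fst_add, Prod.snd_add]
    congr 1
    have h1 := eigenvalue_mul hQ hs' s.2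
    have h2 := eigenvalue_ne_zero hQ s.2
    have h3 := eigenvalue_ne_zero hQ (S.add_mem hs' s.2)
    field_simp
    rw [h1.symm, mul_comm]
  · intro f hf
    simp only [stabilizerProj, LinearMap.smul_apply, LinearMap.sum_apply]
    rw [Finset.sum_congr rfl (g := fun _ => f) (fun s _ => by
      rw [hf s s.2, smul_smul, inv_mul_cancel₀ (eigenvalue_ne_zero hQ s.2), one_smul])]
    rw [Finset.sum_const, Finset.card_univ, ← Nat.cast_smul_eq_nsmul ℂ, smul_smul,
      inv_mul_cancel₀ (Nat.cast_ne_zero.2 Fintype.card_ne_zero), one_smul]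

/-- A stabilizer code defined by `m` stabilizers in length `n` has dimension `q ^ n / m`. -/
theorem card_mul_finrank_stabilizerSpace (hQ : stabilizerSpace S μ ≠ ⊥) :
    Nat.card S * Module.finrank ℂ (stabilizerSpace S μ) = Fintype.card K ^ Fintype.card ι := by
  classical
  have h := (stabilizerProj_isProj hQ).trace
  rw [stabilizerProj, map_smul, map_sum,
    Finset.sum_eq_single (0 : S) (by
      intro s _ hs
      rw [map_smul, trace_errorOp, if_neg, smul_zero]
      rintro ⟨h1, h2⟩
      exact hs (Subtype.ext (Prod.ext h1 h2))) (by simp), map_smul, trace_errorOp,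
    if_pos ⟨rfl, rfl⟩, AddSubgroup.coe_zero, eigenvalue_zero hQ, inv_one, one_smul, smul_eq_mul,
    inv_mul_eq_iff_eq_mul₀ (Nat.cast_ne_zero.2 Fintype.card_ne_zero)] at h
  rw [Nat.card_eq_fintype_card]
  exact_mod_cast h.symm

theorem detects_of_mem [DecidableEq ι] {s : (ι → K) × (ι → K)} (hs : s ∈ S) :
    Detects (stabilizerSpace S μ) (errorOp s.1 s.2) :=
  ⟨μ s, fun f _ g hg => by rw [hg s hs, dotProduct_smul, smul_eq_mul]⟩

/-- An error that fails to commute with some stabilizer maps the code to an orthogonal space. -/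
theorem detects_of_not_commute [DecidableEq ι] {e s : (ι → K) × (ι → K)} (hs : s ∈ S)
    (h : traceChar K (s.2 ⬝ᵥ e.1) ≠ traceChar K (e.2 ⬝ᵥ s.1)) :
    Detects (stabilizerSpace S μ) (errorOp e.1 e.2) := by
  refine ⟨0, fun f hf g hg => ?_⟩
  rw [zero_mul]
  have h1 : traceChar K (e.2 ⬝ᵥ s.1) • errorOp s.1 s.2 (errorOp e.1 e.2 g) =
      traceChar K (s.2 ⬝ᵥ e.1) • μ s • errorOp e.1 e.2 g := by
    rw [← map_smul (errorOp e.1 e.2), ← hg s hs, errorOp_errorOp, errorOp_errorOp, smul_comm,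
      add_comm s.1, add_comm s.2]
  have h2 := star_errorOp_dotProduct s.1 s.2 f f
  have h3 := star_errorOp_dotProduct s.1 s.2 f (errorOp e.1 e.2 g)
  have h4 := congrArg (fun z => star (errorOp s.1 s.2 f) ⬝ᵥ z) h1
  simp only [dotProduct_smul, h3] at h4
  rw [hf s hs] at h2 h4
  simp only [star_smul, smul_dotProduct, dotProduct_smul, smul_eq_mul] at h2 h4
  by_cases hf0 : f = 0
  · simp [hf0]
  have hff : star f ⬝ᵥ f ≠ 0 := by
    open scoped ComplexOrder in
    exact fun hh => hf0 (dotProduct_star_self_eq_zero.1 (by exact hh))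
  have h5 : star (μ s) * μ s = 1 := by
    refine mul_right_cancel₀ hff ?_
    linear_combination h2
  have h6 : (traceChar K (e.2 ⬝ᵥ s.1) - traceChar K (s.2 ⬝ᵥ e.1)) *
      (star f ⬝ᵥ errorOp e.1 e.2 g) = 0 := by
    linear_combination h4 + traceChar K (s.2 ⬝ᵥ e.1) * (star f ⬝ᵥ errorOp e.1 e.2 g) * h5
  exact (mul_eq_zero.1 h6).resolve_left (sub_ne_zero.2 h.symm)

/-- An error outside the stabilizer group that commutes with all stabilizers is undetected: it
preserves the code, and it cannot act on it as a scalar, because the product of the error with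
the projection onto the code has trace zero. -/
theorem not_detects_of_commute [DecidableEq ι] (hQ : stabilizerSpace S μ ≠ ⊥)
    {e : (ι → K) × (ι → K)} (he : e ∉ S)
    (h : ∀ s ∈ S, traceChar K (s.2 ⬝ᵥ e.1) = traceChar K (e.2 ⬝ᵥ s.1)) :
    ¬ Detects (stabilizerSpace S μ) (errorOp e.1 e.2) := by
  classical
  rintro ⟨c, hc⟩
  have hmap : ∀ g ∈ stabilizerSpace S μ, errorOp e.1 e.2 g ∈ stabilizerSpace S μ := by
    intro g hg s hs
    rw [← map_smul, ← hg s hs, errorOp_errorOp, errorOp_errorOp, h s hs, add_comm s.1,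
      add_comm s.2]
  have hscalar : ∀ g ∈ stabilizerSpace S μ, errorOp e.1 e.2 g = c • g := by
    intro g hg
    have h0 : errorOp e.1 e.2 g - c • g ∈ stabilizerSpace S μ :=
      Submodule.sub_mem _ (hmap g hg) (Submodule.smul_mem _ _ hg)
    have h1 := hc _ h0 g hg
    rw [← sub_eq_zero, ← smul_eq_mul, ← dotProduct_smul, ← dotProduct_sub] at h1
    open scoped ComplexOrder in
    exact sub_eq_zero.1 (dotProduct_star_self_eq_zero.1 h1)
  have hc0 : c ≠ 0 := by
    rintro rfl
    obtain ⟨f, hf, hf0⟩ := Submodule.exists_mem_ne_zero_of_ne_bot hQ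
    have := hscalar f hf
    rw [zero_smul] at this
    exact hf0 (errorOp_injective e.1 e.2 (this.trans (map_zero _).symm))
  have hcomp : errorOp e.1 e.2 ∘ₗ stabilizerProj S μ = c • stabilizerProj S μ :=
    LinearMap.ext fun f => hscalar _ ((stabilizerProj_isProj hQ).map_mem f)
  have htr := congrArg (LinearMap.trace ℂ _) hcomp
  have hzero : LinearMap.trace ℂ _ (errorOp e.1 e.2 ∘ₗ stabilizerProj S μ) = 0 := by
    have : errorOp e.1 e.2 ∘ₗ stabilizerProj S μ = (Fintype.card S : ℂ)⁻¹ • ∑ s : S,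
        ((μ s)⁻¹ * traceChar K (e.2 ⬝ᵥ s.1.1)) • errorOp (e.1 + s.1.1) (e.2 + s.1.2) := by
      refine LinearMap.ext fun f => ?_
      simp only [stabilizerProj, LinearMap.comp_apply, LinearMap.smul_apply, LinearMap.sum_apply,
        map_smul, map_sum, errorOp_errorOp, smul_smul]
      congr!
    rw [this, map_smul, map_sum, Finset.sum_eq_zero, smul_zero]
    intro s _
    rw [map_smul, trace_errorOp, if_neg, smul_zero]
    rintro ⟨h1, h2⟩
    refine he ?_
    rw [eq_neg_of_add_eq_zero_left (Prod.ext h1 h2 : e + s.1 = 0)]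
    exact S.neg_mem s.2
  rw [hzero, map_smul, (stabilizerProj_isProj hQ).trace, smul_eq_mul] at htr
  refine mul_ne_zero hc0 (Nat.cast_ne_zero.2 ?_) htr.symm
  rwa [Ne, Submodule.finrank_eq_zero]

end Stabilizer

/-! ### The Hermitian dual -/

section HermitianDual

theorem pow_card_pow_card (K : Type*) {L : Type*} [Fintype K] [Field L] [Fintype L] (hL : Fintype.card L = Fintype.card K ^ 2) (x : L) :
    (x ^ Fintype.card K) ^ Fintype.card K = x := by
  rw [← pow_mul, ← sq, ← hL, FiniteField.pow_card]

variable (K : Type*) {L ι : Type*} [Field K] [Fintype K] [Field L] [Algebra K L]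

theorem add_pow_card (x y : L) :
    (x + y) ^ Fintype.card K = x ^ Fintype.card K + y ^ Fintype.card K :=
  map_add (FiniteField.frobeniusAlgHom K L) x y

theorem sum_pow_card {κ : Type*} (s : Finset κ) (f : κ → L) :
    (∑ i ∈ s, f i) ^ Fintype.card K = ∑ i ∈ s, f i ^ Fintype.card K :=
  map_sum (FiniteField.frobeniusAlgHom K L) f s

/-- The image of a code under the coordinatewise `q`-th power, which is an involution; it is
encoded as a preimage. -/
def conjCode (C : Submodule L (ι → L)) : Submodule L (ι → L) where
  carrier := {x | (fun i => x i ^ Fintype.card K) ∈ C}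
  zero_mem' := by
    have : (fun i => (0 : ι → L) i ^ Fintype.card K) = 0 := by
      ext i
      simp [Fintype.card_ne_zero]
    change _ ∈ C
    rw [this]
    exact C.zero_mem
  add_mem' := by
    intro x y hx hy
    change (fun i => (x i + y i) ^ Fintype.card K) ∈ C
    simp only [add_pow_card K]
    exact C.add_mem hx hy
  smul_mem' := by
    intro c x hx
    change (fun i => (c * x i) ^ Fintype.card K) ∈ C
    simp only [mul_pow]
    exact C.smul_mem (c ^ Fintype.card K) hx

variable [Fintype L] [Fintype ι]

theorem finrank_conjCode (hL : Fintype.card L = Fintype.card K ^ 2) (C : Submodule L (ι → L)) :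
    Module.finrank L (conjCode K C) = Module.finrank L C := by
  have h : Nat.card (conjCode K C) = Nat.card C := by
    refine Nat.card_congr
      { toFun := fun x => ⟨fun i => x.1 i ^ Fintype.card K, x.2⟩
        invFun := fun x => ⟨fun i => x.1 i ^ Fintype.card K, ?_⟩
        left_inv := fun x => Subtype.ext (funext fun i => pow_card_pow_card K hL _)
        right_inv := fun x => Subtype.ext (funext fun i => pow_card_pow_card K hL _) }
    change (fun i => (x.1 i ^ Fintype.card K) ^ Fintype.card K) ∈ C
    simp only [pow_card_pow_card K hL]
    exact x.2
  rw [Module.natCard_eq_pow_finrank (K := L), Module.natCard_eq_pow_finrank (K := L) (V := C)] at h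
  exact Nat.pow_right_injective (Nat.card_eq_fintype_card (α := L) ▸ Fintype.one_lt_card) h

theorem finrank_hermitianDual (hL : Fintype.card L = Fintype.card K ^ 2)
    (C : Submodule L (ι → L)) :
    Module.finrank L (hermitianDual (Fintype.card K) C) + Module.finrank L C =
      Fintype.card ι := by
  classical
  have h : hermitianDual (Fintype.card K) C =
      (Matrix.toBilin' (1 : Matrix ι ι L)).orthogonal (conjCode K C) := by
    ext x
    rw [LinearMap.BilinForm.mem_orthogonal_iff]
    simp only [Matrix.toBilin'_apply', Matrix.one_mulVec]
    constructor
    · intro hx y hy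
      have := hx _ hy
      simp only [pow_card_pow_card K hL] at this
      rwa [dotProduct_comm]
    · intro hx y hy
      have hy' : (fun i => y i ^ Fintype.card K) ∈ conjCode K C := by
        change (fun i => (y i ^ Fintype.card K) ^ Fintype.card K) ∈ C
        simpa only [pow_card_pow_card K hL] using hy
      have := hx _ hy'
      rwa [dotProduct_comm] at this
  have hnd : (Matrix.toBilin' (1 : Matrix ι ι L)).Nondegenerate :=
    Matrix.nondegenerate_toBilin'_iff.2 (Matrix.nondegenerate_of_det_ne_zero (by simp))
  have hle := Submodule.finrank_le C
  rw [h, LinearMap.BilinForm.finrank_orthogonal hnd, finrank_conjCode K hL]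
  rw [Module.finrank_fintype_fun_eq_card] at *
  omega

variable {K}

theorem hermitian_symm (hL : Fintype.card L = Fintype.card K ^ 2) {x y : ι → L}
    (h : ∑ i, x i * y i ^ Fintype.card K = 0) : ∑ i, y i * x i ^ Fintype.card K = 0 := by
  have := sum_pow_card K Finset.univ (fun i => x i * y i ^ Fintype.card K)
  simp only [h, mul_pow, pow_card_pow_card K hL, zero_pow Fintype.card_ne_zero] at this
  rw [this]
  exact Finset.sum_congr rfl fun i _ => mul_comm _ _

theorem hermitianDual_hermitianDual (hL : Fintype.card L = Fintype.card K ^ 2)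
    (C : Submodule L (ι → L)) :
    hermitianDual (Fintype.card K) (hermitianDual (Fintype.card K) C) = C := by
  symm
  refine Submodule.eq_of_le_of_finrank_eq (fun x hx y hy => hermitian_symm hL (hy x hx)) ?_
  have h1 := finrank_hermitianDual K hL C
  have h2 := finrank_hermitianDual K hL (hermitianDual (Fintype.card K) C)
  omega

end HermitianDual

/-! ### The stabilizer construction from Hermitian dual-containing codes -/

section Induced

variable {K L ι : Type*} [Field K] [Fintype K] [Field L] [Algebra K L]

/-- A primitive element `β` of `L` gives a normal basis `β, β ^ q` over the subfield with `q`
elements. -/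
theorem exists_linearIndependent_frobenius [Fintype L] (hL : Fintype.card L = Fintype.card K ^ 2) :
    ∃ β : L, LinearIndependent K ![β, β ^ Fintype.card K] := by
  classical
  obtain ⟨g, hg⟩ := IsCyclic.exists_generator (α := Lˣ)
  have hq : 1 < Fintype.card K := Fintype.one_lt_card
  have hord : orderOf g = Fintype.card K ^ 2 - 1 := by
    rw [orderOf_eq_card_of_forall_mem_zpowers hg, Nat.card_eq_fintype_card, Fintype.card_units, hL]
  refine ⟨g, (LinearIndependent.pair_iff' g.ne_zero).2 fun c hc => ?_⟩
  have hc0 : c ≠ 0 := by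
    rintro rfl
    rw [zero_smul] at hc
    exact pow_ne_zero _ g.ne_zero hc.symm
  have h1 : algebraMap K L c = (g : L) ^ (Fintype.card K - 1) := by
    refine mul_right_cancel₀ g.ne_zero ?_
    rw [← Algebra.smul_def, hc, ← pow_succ, Nat.sub_add_cancel hq.le]
  have h2 : (g : L) ^ ((Fintype.card K - 1) * (Fintype.card K - 1)) = 1 := by
    rw [pow_mul, ← h1, ← map_pow, FiniteField.pow_card_sub_one_eq_one c hc0, map_one]
  have h3 : orderOf g ∣ (Fintype.card K - 1) * (Fintype.card K - 1) :=
    orderOf_dvd_of_pow_eq_one (Units.ext (by simpa using h2))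
  obtain ⟨m, hm⟩ : ∃ m, Fintype.card K = m + 2 := ⟨Fintype.card K - 2, by omega⟩
  rw [hord, hm] at h3
  have h4 : (m + 2) ^ 2 - 1 = (m + 1) * (m + 3) := by
    rw [Nat.sub_eq_iff_eq_add (Nat.one_le_pow _ _ (by omega))]
    ring
  rw [h4, show m + 2 - 1 = m + 1 by omega, Nat.mul_dvd_mul_iff_left (by omega)] at h3
  have := Nat.le_of_dvd (by omega) h3
  omega

/-- The word `β a + β ^ q b` over `L` that represents the error operator `X(a) Z(b)`. -/
def errorWord (β : L) : (ι → K) × (ι → K) →+ (ι → L) where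
  toFun e := fun i => e.1 i • β + e.2 i • β ^ Fintype.card K
  map_zero' := by ext; simp
  map_add' e e' := by
    ext
    simp only [Prod.fst_add, Prod.snd_add, Pi.add_apply, add_smul]
    ring

theorem errorWord_apply (β : L) (e : (ι → K) × (ι → K)) (i : ι) :
    errorWord β e i = e.1 i • β + e.2 i • β ^ Fintype.card K := rfl

theorem errorWord_eq_zero_iff {β : L} (hβ : LinearIndependent K ![β, β ^ Fintype.card K])
    (e : (ι → K) × (ι → K)) (i : ι) : errorWord β e i = 0 ↔ e.1 i = 0 ∧ e.2 i = 0 := by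
  rw [errorWord_apply]
  exact ⟨LinearIndependent.pair_iff.1 hβ _ _, fun h => by rw [h.1, h.2, zero_smul, zero_smul,
    add_zero]⟩

theorem errorWeight_eq {β : L} (hβ : LinearIndependent K ![β, β ^ Fintype.card K])
    (e : (ι → K) × (ι → K)) : errorWeight e.1 e.2 = Set.ncard {i | errorWord β e i ≠ 0} := by
  simp only [errorWeight, Ne, errorWord_eq_zero_iff hβ, not_and_or]

theorem sq_sub_sq_frobenius_ne_zero {β : L}
    (hβ : LinearIndependent K ![β, β ^ Fintype.card K]) :
    β ^ 2 - (β ^ Fintype.card K) ^ 2 ≠ 0 := by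
  rw [LinearIndependent.pair_iff] at hβ
  intro h
  rw [sq_sub_sq] at h
  rcases mul_eq_zero.1 h with h | h
  · exact one_ne_zero (hβ 1 1 (by rwa [one_smul, one_smul])).1
  · exact one_ne_zero (hβ 1 (-1) (by rwa [neg_smul, one_smul, one_smul, ← sub_eq_add_neg])).1

variable [Fintype ι]

/-- The group of those errors whose words lie in the Hermitian dual of `C`. -/
def stabilizerOf (β : L) (C : Submodule L (ι → L)) : AddSubgroup ((ι → K) × (ι → K)) :=
  (hermitianDual (Fintype.card K) C).toAddSubgroup.comap (errorWord β)

theorem mem_stabilizerOf {β : L} {C : Submodule L (ι → L)} {e : (ι → K) × (ι → K)} :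
    e ∈ stabilizerOf β C ↔ errorWord β e ∈ hermitianDual (Fintype.card K) C := Iff.rfl

variable [Fintype L]

theorem errorWord_bijective (hL : Fintype.card L = Fintype.card K ^ 2) {β : L}
    (hβ : LinearIndependent K ![β, β ^ Fintype.card K]) :
    Function.Bijective (errorWord β : (ι → K) × (ι → K) →+ (ι → L)) := by
  classical
  rw [Fintype.bijective_iff_injective_and_card]
  constructor
  · rw [injective_iff_map_eq_zero]
    intro e he
    have h : ∀ i, e.1 i = 0 ∧ e.2 i = 0 := fun i =>
      (errorWord_eq_zero_iff hβ e i).1 (congrFun he i)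
    exact Prod.ext (funext fun i => (h i).1) (funext fun i => (h i).2)
  · rw [Fintype.card_prod, Fintype.card_fun, Fintype.card_fun, hL, ← pow_add, ← pow_mul, two_mul]

/-- The antisymmetrized Hermitian form is a multiple of the symplectic form which governs the
commutation of error operators. -/
theorem hermitian_errorWord_sub (hL : Fintype.card L = Fintype.card K ^ 2) (β : L)
    (e s : (ι → K) × (ι → K)) :
    (∑ i, errorWord β e i * errorWord β s i ^ Fintype.card K) -
        (∑ i, errorWord β e i * errorWord β s i ^ Fintype.card K) ^ Fintype.card K =
      algebraMap K L (s.2 ⬝ᵥ e.1 - e.2 ⬝ᵥ s.1) * (β ^ 2 - (β ^ Fintype.card K) ^ 2) := by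
  rw [sum_pow_card, ← Finset.sum_sub_distrib, dotProduct, dotProduct, ← Finset.sum_sub_distrib,
    map_sum, Finset.sum_mul]
  refine Finset.sum_congr rfl fun i _ => ?_
  simp only [errorWord_apply, add_pow_card K, mul_pow, pow_card_pow_card K hL,
    Algebra.smul_def, map_sub, map_mul, ← map_pow, FiniteField.pow_card]
  ring

theorem dotProduct_eq_of_hermitian (hL : Fintype.card L = Fintype.card K ^ 2) {β : L}
    (hβ : LinearIndependent K ![β, β ^ Fintype.card K]) {e s : (ι → K) × (ι → K)}
    (h : ∑ i, errorWord β e i * errorWord β s i ^ Fintype.card K = 0) :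
    s.2 ⬝ᵥ e.1 = e.2 ⬝ᵥ s.1 := by
  have h1 := hermitian_errorWord_sub hL β e s
  rw [h, zero_pow Fintype.card_ne_zero, sub_zero] at h1
  have h2 := (mul_eq_zero.1 h1.symm).resolve_right (sq_sub_sq_frobenius_ne_zero hβ)
  exact sub_eq_zero.1 ((map_eq_zero _).1 h2)

theorem card_stabilizerOf (hL : Fintype.card L = Fintype.card K ^ 2) {β : L}
    (hβ : LinearIndependent K ![β, β ^ Fintype.card K]) (C : Submodule L (ι → L)) :
    Nat.card (stabilizerOf (K := K) β C) =
      Fintype.card K ^ (2 * Module.finrank L (hermitianDual (Fintype.card K) C)) := by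
  have h : Nat.card (stabilizerOf (K := K) β C) = Nat.card (hermitianDual (Fintype.card K) C) :=
    Nat.card_congr ((Equiv.ofBijective _ (errorWord_bijective hL hβ)).subtypeEquiv
      fun e => mem_stabilizerOf)
  rw [h, Module.natCard_eq_pow_finrank (K := L), Nat.card_eq_fintype_card, hL, ← pow_mul]

/-- The errors which commute with all stabilizers are those with a word in `C`. -/
theorem errorWord_mem_of_commute (hL : Fintype.card L = Fintype.card K ^ 2) {β : L}
    (hβ : LinearIndependent K ![β, β ^ Fintype.card K]) {C : Submodule L (ι → L)}
    {e : (ι → K) × (ι → K)}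
    (h : ∀ s ∈ stabilizerOf β C, traceChar K (s.2 ⬝ᵥ e.1) = traceChar K (e.2 ⬝ᵥ s.1)) :
    errorWord β e ∈ C := by
  -- The stabilizer group is stable under scalars from `K`, so the trace can be removed.
  have hdot : ∀ s ∈ stabilizerOf β C, s.2 ⬝ᵥ e.1 = e.2 ⬝ᵥ s.1 := by
    intro s hs
    by_contra hne
    obtain ⟨c, hc⟩ := exists_traceChar_mul_ne_one (sub_ne_zero.2 hne)
    have hcs : c • s ∈ stabilizerOf β C := by
      rw [mem_stabilizerOf] at hs ⊢
      have : errorWord β (c • s) = algebraMap K L c • errorWord β s := by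
        ext i
        simp only [errorWord_apply, Prod.smul_fst, Prod.smul_snd, Pi.smul_apply, smul_assoc,
          ← smul_add, algebraMap_smul]
      rw [this]
      exact Submodule.smul_mem _ _ hs
    have h1 := h _ hcs
    rw [Prod.smul_fst, Prod.smul_snd, smul_dotProduct, dotProduct_smul, smul_eq_mul,
      smul_eq_mul] at h1
    refine hc ?_
    rw [mul_sub, AddChar.map_sub_eq_div, h1, div_self]
    exact norm_ne_zero_iff.1 (by rw [AddChar.norm_apply]; exact one_ne_zero)
  have hfix : ∀ y ∈ hermitianDual (Fintype.card K) C,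
      (∑ i, errorWord β e i * y i ^ Fintype.card K) ^ Fintype.card K =
        ∑ i, errorWord β e i * y i ^ Fintype.card K := by
    intro y hy
    obtain ⟨s, rfl⟩ := (errorWord_bijective hL hβ).2 y
    have h1 := hermitian_errorWord_sub hL β e s
    rw [hdot s hy, sub_self, map_zero, zero_mul] at h1
    exact (sub_eq_zero.1 h1).symm
  rw [← hermitianDual_hermitianDual hL C]
  intro y hy
  -- Both `z` and `β ^ q * z` are fixed by the Frobenius map, which forces `z = 0`.
  have h1 := hfix y hy
  have h2 := hfix (β • y) (Submodule.smul_mem _ _ hy)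
  simp only [Pi.smul_apply, smul_eq_mul, mul_pow, mul_left_comm, ← Finset.mul_sum] at h2
  rw [h1, pow_card_pow_card K hL] at h2
  have h3 := sq_sub_sq_frobenius_ne_zero hβ
  by_contra hz
  exact h3 (by rw [← mul_right_cancel₀ hz h2, sub_self])

/-- The stabilizer construction: a Hermitian dual-containing code of dimension `(n + k) / 2` and
minimum distance `d`, which is attained outside the dual, induces an `[[n, k, d]]_q` code. -/
theorem exists_quantumCode [DecidableEq ι] (hL : Fintype.card L = Fintype.card K ^ 2) {n k d : ℕ}
    (C : Submodule L (ι → L)) (hn : Fintype.card ι = n)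
    (hdual : hermitianDual (Fintype.card K) C ≤ C) (hk : 2 * Module.finrank L C = n + k)
    (hd : minDist C = d)
    (hx : ∃ x ∈ C, x ∉ hermitianDual (Fintype.card K) C ∧ Set.ncard {i | x i ≠ 0} = d) :
    ∃ Q : Submodule ℂ ((ι → K) → ℂ), IsInducedBy C Q ∧ IsQuantumCode n k d Q := by
  obtain ⟨β, hβ⟩ := exists_linearIndependent_frobenius hL
  have hcomm : ∀ e, errorWord β e ∈ C → ∀ s ∈ stabilizerOf β C,
      traceChar K (s.2 ⬝ᵥ e.1) = traceChar K (e.2 ⬝ᵥ s.1) := fun e he s hs =>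
    congrArg _ (dotProduct_eq_of_hermitian hL hβ (hermitian_symm hL (hs _ he)))
  obtain ⟨μ, hQ⟩ := exists_stabilizerSpace_ne_bot (stabilizerOf (K := K) β C)
    fun s hs s' hs' => (hcomm s (hdual hs) s' hs').symm
  refine ⟨stabilizerSpace (stabilizerOf β C) μ, ⟨hQ, β, hβ, fun a b => μ (a, b), fun f =>
    ⟨fun hf a b hab => hf (a, b) hab, fun hf s hs => hf s.1 s.2 hs⟩⟩, hn, ?_, ?_, ?_⟩
  · have h1 := card_mul_finrank_stabilizerSpace hQ
    have h2 := finrank_hermitianDual K hL C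
    rw [card_stabilizerOf hL hβ] at h1
    rw [show Fintype.card ι = 2 * Module.finrank L (hermitianDual (Fintype.card K) C) + k by omega,
      pow_add] at h1
    exact mul_left_cancel₀ (pow_ne_zero _ Fintype.card_ne_zero) h1
  · intro a b hab
    by_cases he : (a, b) ∈ stabilizerOf β C
    · exact detects_of_mem (s := (a, b)) he
    have heC : errorWord β (a, b) ∉ C := by
      intro heC
      have h0 : errorWord β (a, b) ≠ 0 := fun h0 => he (by
        rw [mem_stabilizerOf, h0]
        exact Submodule.zero_mem _)
      have h1 : minDist C ≤ (Set.ncard {i | errorWord β (a, b) i ≠ 0} : ℕ∞) :=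
        iInf₂_le_of_le _ heC (iInf_le_of_le h0 le_rfl)
      rw [hd, ← errorWeight_eq hβ] at h1
      have h2 : d ≤ errorWeight a b := by exact_mod_cast h1
      exact absurd h2 (not_le.2 hab)
    have hex : ∃ s ∈ stabilizerOf β C,
        traceChar K (s.2 ⬝ᵥ a) ≠ traceChar K (b ⬝ᵥ s.1) := by
      by_contra! hno
      exact heC (errorWord_mem_of_commute hL hβ hno)
    obtain ⟨s, hs, hne⟩ := hex
    exact detects_of_not_commute (e := (a, b)) hs hne
  · obtain ⟨x, hxC, hxD, hw⟩ := hx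
    obtain ⟨e, rfl⟩ := (errorWord_bijective hL hβ).2 x
    exact ⟨e.1, e.2, (errorWeight_eq hβ e).trans hw, not_detects_of_commute hQ hxD (hcomm e hxC)⟩

end Induced

/-! ### Reed–Solomon codes on the multiplicative group of the subfield -/

section ReedSolomon

open Polynomial

/-- The code of length `q - 1` over `L`, with coordinates indexed by `Kˣ`, which has the parity
checks `y ↦ y ^ (i + 1)` for `i < m`. The checks are given through all polynomials `X * p` with
`deg p < m` at once. -/
def rsCode (K L : Type*) [Field K] [Fintype Kˣ] [Field L] [Algebra K L] (m : ℕ) :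
    Submodule L (Kˣ → L) where
  carrier := {f | ∀ p ∈ degreeLT L m,
    ∑ y : Kˣ, f y * (algebraMap K L y * p.eval (algebraMap K L y)) = 0}
  zero_mem' := by intro p _; simp
  add_mem' := by
    intro f g hf hg p hp
    simp only [Pi.add_apply, add_mul, Finset.sum_add_distrib, hf p hp, hg p hp, add_zero]
  smul_mem' := by
    intro c f hf p hp
    simp only [Pi.smul_apply, smul_eq_mul, mul_assoc, ← Finset.mul_sum, hf p hp, mul_zero]

variable {K L : Type*} [Field K] [Field L] [Algebra K L]

theorem algebraMap_units_injective :
    Function.Injective (fun y : Kˣ => algebraMap K L y) :=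
  (algebraMap K L).injective.comp Units.val_injective

theorem algebraMap_units_ne_zero (y : Kˣ) : algebraMap K L y ≠ 0 :=
  (_root_.map_ne_zero _).2 y.ne_zero

theorem rsCode_mono [Fintype Kˣ] {m m' : ℕ} (h : m ≤ m') : rsCode K L m' ≤ rsCode K L m :=
  fun _ hf p hp => hf p (degreeLT_mono h hp)

theorem X_pow_mul_mem_degreeLT {u v : ℕ} {p : L[X]} (hp : p ∈ degreeLT L v) :
    X ^ u * p ∈ degreeLT L (u + v) := by
  rw [mem_degreeLT] at hp ⊢
  by_cases h0 : p = 0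
  · rw [h0, mul_zero, degree_zero]
    exact WithBot.bot_lt_coe _
  rw [degree_mul, degree_X_pow, Nat.cast_add]
  exact WithBot.add_lt_add_left (WithBot.natCast_ne_bot u) hp

theorem exists_eq_add_X_pow_mul {u v : ℕ} {p : L[X]} (hp : p ∈ degreeLT L (u + v)) :
    ∃ a ∈ degreeLT L u, ∃ b ∈ degreeLT L v, p = a + X ^ u * b := by
  refine ⟨p %ₘ X ^ u, ?_, p /ₘ X ^ u, ?_, (modByMonic_add_div p (X ^ u)).symm⟩
  · rw [mem_degreeLT]
    simpa using degree_modByMonic_lt p (monic_X_pow (R := L) u)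
  · rw [mem_degreeLT, degree_lt_iff_coeff_zero] at *
    intro m hm
    have h1 := hp (u + m) (by omega)
    have h2 : (p %ₘ X ^ u).coeff (u + m) = 0 := by
      refine coeff_eq_zero_of_degree_lt
        ((degree_modByMonic_lt p (monic_X_pow (R := L) u)).trans_le ?_)
      rw [degree_X_pow]
      exact_mod_cast Nat.le_add_right u m
    rw [← modByMonic_add_div p (X ^ u : L[X]), coeff_add, h2, zero_add, add_comm u m,
      coeff_X_pow_mul] at h1
    exact h1

/-- The BCH bound: testing a codeword of weight at most `m` against the polynomial that vanishes
on all but one point of its support shows that the codeword is zero. -/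
theorem lt_ncard_of_mem_rsCode [Fintype Kˣ] {m : ℕ} {f : Kˣ → L} (hf : f ∈ rsCode K L m)
    (h0 : f ≠ 0) : m < Set.ncard {y | f y ≠ 0} := by
  classical
  obtain ⟨y₀, hy₀⟩ := Function.ne_iff.1 h0
  by_contra! hle
  rw [Set.ncard_eq_toFinset_card'] at hle
  set T := ({y | f y ≠ 0} : Set Kˣ).toFinset with hT
  have hmem : ∀ y, y ∈ T ↔ f y ≠ 0 := fun y => by simp [hT]
  let p : L[X] := ∏ z ∈ T.erase y₀, (X - C (algebraMap K L z))
  have hdeg : p ∈ degreeLT L m := by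
    rw [mem_degreeLT, degree_prod]
    simp only [degree_X_sub_C, Finset.sum_const, Finset.card_erase_of_mem ((hmem y₀).2 hy₀)]
    have : 0 < T.card := Finset.card_pos.2 ⟨y₀, (hmem y₀).2 hy₀⟩
    rw [nsmul_one]
    exact_mod_cast (by omega : T.card - 1 < m)
  have h1 := hf p hdeg
  rw [Finset.sum_eq_single y₀] at h1
  · refine mul_ne_zero hy₀ (mul_ne_zero (algebraMap_units_ne_zero y₀) ?_) h1
    rw [eval_prod, Finset.prod_ne_zero_iff]
    intro z hz
    rw [eval_sub, eval_X, eval_C, sub_ne_zero]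
    exact fun h => (Finset.mem_erase.1 hz).1 (algebraMap_units_injective h).symm
  · intro y _ hy
    by_cases hfy : f y = 0
    · rw [hfy, zero_mul]
    · have : p.eval (algebraMap K L y) = 0 := by
        rw [eval_prod]
        refine Finset.prod_eq_zero (Finset.mem_erase.2 ⟨hy, (hmem y).2 hfy⟩) ?_
        simp
      rw [this, mul_zero, mul_zero]
  · simp

/-- The BCH bound is attained: `m` linear conditions on words supported on `m + 1` points have a
nonzero solution. -/
theorem exists_mem_rsCode_ncard [Fintype Kˣ] {m : ℕ} (hm : m < Fintype.card Kˣ) :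
    ∃ f ∈ rsCode K L m, f ≠ 0 ∧ Set.ncard {y | f y ≠ 0} = m + 1 := by
  classical
  obtain ⟨T, -, hT⟩ := Finset.exists_subset_card_eq (s := (Finset.univ : Finset Kˣ)) (n := m + 1)
    (by rwa [Finset.card_univ])
  let φ : (T → L) →ₗ[L] Module.Dual L (degreeLT L m) := LinearMap.mk₂ L
    (fun f p => ∑ y : T, f y * (algebraMap K L y.1 * p.1.eval (algebraMap K L y.1)))
    (by intro f g p; simp only [Pi.add_apply, add_mul, Finset.sum_add_distrib])
    (by intro c f p; simp only [Pi.smul_apply, smul_eq_mul, mul_assoc, Finset.mul_sum])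
    (by
      intro f p p'
      simp only [Submodule.coe_add, eval_add, mul_add, Finset.sum_add_distrib])
    (by
      intro c f p
      simp only [Submodule.coe_smul, eval_smul, smul_eq_mul, Finset.mul_sum]
      exact Finset.sum_congr rfl fun y _ => by ring)
  have : FiniteDimensional L (degreeLT L m) := (degreeLTEquiv L m).symm.finiteDimensional
  have hker : φ.ker ≠ ⊥ := by
    refine LinearMap.ker_ne_bot_of_finrank_lt ?_
    rw [Subspace.dual_finrank_eq, (degreeLTEquiv L m).finrank_eq, Module.finrank_fin_fun,
      Module.finrank_fintype_fun_eq_card, Fintype.card_coe, hT]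
    exact Nat.lt_succ_self m
  obtain ⟨f, hf, hf0⟩ := Submodule.exists_mem_ne_zero_of_ne_bot hker
  let g : Kˣ → L := fun y => if h : y ∈ T then f ⟨y, h⟩ else 0
  have hg : g ∈ rsCode K L m := by
    intro p hp
    have h1 : φ f ⟨p, hp⟩ = 0 := by rw [LinearMap.mem_ker.1 hf, LinearMap.zero_apply]
    change ∑ y : T, f y * (algebraMap K L y.1 * p.eval (algebraMap K L y.1)) = 0 at h1
    rw [← Finset.sum_subset (Finset.subset_univ T), ← Finset.sum_coe_sort T]
    · rw [← h1]
      exact Finset.sum_congr rfl fun y _ => by simp [g]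
    · intro y _ hy
      simp [g, hy]
  have hg0 : g ≠ 0 := by
    intro h
    refine hf0 (funext fun y => ?_)
    simpa [g] using congrFun h y.1
  refine ⟨g, hg, hg0, le_antisymm ?_ (lt_ncard_of_mem_rsCode hg hg0)⟩
  rw [← hT, ← Set.ncard_coe_finset T]
  refine Set.ncard_le_ncard (fun y hy => ?_) (Set.toFinite _)
  by_contra h
  exact hy (dif_neg h)

/-- A polynomial has few zeros, so its word of values has large weight. -/
theorem card_units_lt_ncard_add [Fintype Kˣ] {m : ℕ} {p : L[X]} (hp : p ∈ degreeLT L m)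
    (h0 : p ≠ 0) :
    Fintype.card Kˣ <
      Set.ncard {y : Kˣ | algebraMap K L y * p.eval (algebraMap K L y) ≠ 0} + m := by
  classical
  have h1 : Set.ncard {y : Kˣ | algebraMap K L y * p.eval (algebraMap K L y) ≠ 0}ᶜ
      ≤ p.natDegree := by
    rw [Set.ncard_eq_toFinset_card']
    refine le_trans ?_ (card_roots' p)
    refine le_trans ?_ (Multiset.toFinset_card_le p.roots)
    refine Finset.card_le_card_of_injOn (fun y : Kˣ => algebraMap K L y) (fun y hy => ?_)
      algebraMap_units_injective.injOn
    simp only [Set.coe_toFinset, Set.mem_compl_iff, Set.mem_ofPred_eq, not_not, mul_eq_zero,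
      algebraMap_units_ne_zero y, false_or] at hy
    simp [h0, hy]
  have h2 := Set.ncard_add_ncard_compl
    {y : Kˣ | algebraMap K L y * p.eval (algebraMap K L y) ≠ 0} (Set.toFinite _) (Set.toFinite _)
  rw [Nat.card_eq_fintype_card] at h2
  have h3 : p.natDegree < m := by
    rw [mem_degreeLT] at hp
    exact (natDegree_lt_iff_degree_lt h0).2 hp
  omega

theorem sum_units_mul_eval_mul_eval [Fintype K] [Fintype Kˣ] {m m' : ℕ} {p p' : L[X]}
    (hp : p ∈ degreeLT L m) (hp' : p' ∈ degreeLT L m') (h : m + m' < Fintype.card K - 1) :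
    ∑ y : Kˣ, (algebraMap K L y * p.eval (algebraMap K L y)) *
      (algebraMap K L y * p'.eval (algebraMap K L y)) = 0 := by
  classical
  by_cases h0 : p = 0
  · simp [h0]
  by_cases h0' : p' = 0
  · simp [h0']
  have hd : (p * p').natDegree + 2 ≤ m + m' := by
    rw [natDegree_mul h0 h0']
    have h1 := (natDegree_lt_iff_degree_lt h0).2 (mem_degreeLT.1 hp)
    have h2 := (natDegree_lt_iff_degree_lt h0').2 (mem_degreeLT.1 hp')
    omega
  have hterm : ∀ y : Kˣ, (algebraMap K L y * p.eval (algebraMap K L y)) *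
      (algebraMap K L y * p'.eval (algebraMap K L y)) =
      ∑ i ∈ Finset.range ((p * p').natDegree + 1),
        (p * p').coeff i * algebraMap K L ((y : K) ^ (i + 2)) := by
    intro y
    rw [mul_mul_mul_comm, ← eval_mul, eval_eq_sum_range, Finset.mul_sum]
    refine Finset.sum_congr rfl fun i _ => ?_
    rw [map_pow]
    ring
  simp only [hterm]
  rw [Finset.sum_comm]
  refine Finset.sum_eq_zero fun i hi => ?_
  have hi' := Finset.mem_range.1 hi
  have hs : ∑ y : Kˣ, (y : K) ^ (i + 2) = 0 := by
    have h1 := FiniteField.sum_pow_units K (i + 2)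
    rw [if_neg (fun hdvd => by have := Nat.le_of_dvd (by omega) hdvd; omega)] at h1
    convert h1
  rw [← Finset.mul_sum, ← map_sum, hs, map_zero, mul_zero]

end ReedSolomon

/-! ### Locally recoverable codes from groups of Reed–Solomon checks -/

section GroupedCode

open Polynomial

variable {K L ι G : Type*} [Field K] [Fintype K] [DecidableEq K] [Field L] [Algebra K L]
  [Fintype ι] [Fintype G]

/-- The coordinates of the word `x` in the group `g`, a copy of `Kˣ`. -/
def slice (e : ι ≃ G × Kˣ) (x : ι → L) (g : G) : Kˣ → L := fun y => x (e.symm (g, y))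

/-- The code whose coordinates are arranged in groups, each a copy of `Kˣ`, with the parity checks
`y ^ (i + 1)`, `i < u`, on each single group, and `v` further parity checks which are `y ^ (i + 1)`,
`u ≤ i < u + v`, on all groups at once, scaled by `ν g` on the group `g`. -/
def groupedCode (e : ι ≃ G × Kˣ) (ν : G → L) (u v : ℕ) : Submodule L (ι → L) where
  carrier := {x | (∀ g, slice e x g ∈ rsCode K L u) ∧ ∀ p ∈ degreeLT L v,
    ∑ g, ν g * ∑ y : Kˣ, slice e x g y *
      (algebraMap K L y * (X ^ u * p).eval (algebraMap K L y)) = 0}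
  zero_mem' := ⟨fun _ => Submodule.zero_mem _, by intro p _; simp [slice]⟩
  add_mem' := by
    rintro x z ⟨hx, hx'⟩ ⟨hz, hz'⟩
    refine ⟨fun g => Submodule.add_mem _ (hx g) (hz g), fun p hp => ?_⟩
    have h : ∀ g y, slice e (x + z) g y = slice e x g y + slice e z g y := fun _ _ => rfl
    simp only [h, add_mul, mul_add, Finset.sum_add_distrib]
    simp only [hx' p hp, hz' p hp, add_zero]
  smul_mem' := by
    rintro c x ⟨hx, hx'⟩
    refine ⟨fun g => Submodule.smul_mem _ c (hx g), fun p hp => ?_⟩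
    have h : ∀ g y, slice e (c • x) g y = c * slice e x g y := fun _ _ => rfl
    simp only [h, mul_assoc, ← Finset.mul_sum, mul_left_comm (ν _) c]
    rw [hx' p hp, mul_zero]

omit [Fintype ι] in
theorem mem_groupedCode {e : ι ≃ G × Kˣ} {ν : G → L} {u v : ℕ} {x : ι → L} :
    x ∈ groupedCode e ν u v ↔ (∀ g, slice e x g ∈ rsCode K L u) ∧ ∀ p ∈ degreeLT L v,
      ∑ g, ν g * ∑ y : Kˣ, slice e x g y *
        (algebraMap K L y * (X ^ u * p).eval (algebraMap K L y)) = 0 := Iff.rfl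

omit [Fintype K] [Fintype G] [Fintype ι] [DecidableEq K] [Algebra K L] in
theorem exists_slice_ne_zero (e : ι ≃ G × Kˣ) {x : ι → L} (hx : x ≠ 0) :
    ∃ g, slice e x g ≠ 0 := by
  obtain ⟨k, hk⟩ := Function.ne_iff.1 hx
  refine ⟨(e k).1, Function.ne_iff.2 ⟨(e k).2, ?_⟩⟩
  simpa [slice] using hk

omit [Algebra K L] in
theorem ncard_support_eq_sum (e : ι ≃ G × Kˣ) (x : ι → L) :
    Set.ncard {k | x k ≠ 0} = ∑ g, Set.ncard {y | slice e x g y ≠ 0} := by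
  classical
  simp only [Set.ncard_eq_toFinset_card', Set.toFinset_ofPred, Finset.card_filter]
  rw [← Equiv.sum_comp e.symm, Fintype.sum_prod_type]
  rfl

omit [Algebra K L] in
theorem ncard_slice_le (e : ι ≃ G × Kˣ) (x : ι → L) (g : G) :
    Set.ncard {y | slice e x g y ≠ 0} ≤ Set.ncard {k | x k ≠ 0} := by
  rw [ncard_support_eq_sum e x]
  exact Finset.single_le_sum (f := fun g => Set.ncard {y | slice e x g y ≠ 0})
    (fun _ _ => Nat.zero_le _) (Finset.mem_univ g)

/-- A nonzero codeword satisfies the distance bound `u + 1` in each group it meets. If it meets two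
groups then these contribute enough; if it meets one group only then all `u + v` checks apply to
that group. -/
theorem lt_ncard_of_mem_groupedCode {e : ι ≃ G × Kˣ} {ν : G → L} (hν : ∀ g, ν g ≠ 0) {u v : ℕ}
    (hvu : v ≤ u) {x : ι → L} (hx : x ∈ groupedCode e ν u v) (h0 : x ≠ 0) :
    u + v < Set.ncard {k | x k ≠ 0} := by
  classical
  obtain ⟨g, hg⟩ := exists_slice_ne_zero e h0
  by_cases h : ∃ g', g' ≠ g ∧ slice e x g' ≠ 0
  · obtain ⟨g', hne, hg'⟩ := h
    have h1 := lt_ncard_of_mem_rsCode (hx.1 g) hg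
    have h2 := lt_ncard_of_mem_rsCode (hx.1 g') hg'
    have h3 := Finset.add_le_sum (f := fun g => Set.ncard {y | slice e x g y ≠ 0})
      (fun _ _ => Nat.zero_le _) (Finset.mem_univ g) (Finset.mem_univ g') hne.symm
    rw [← ncard_support_eq_sum] at h3
    omega
  · push Not at h
    refine lt_of_lt_of_le (lt_ncard_of_mem_rsCode ?_ hg) (ncard_slice_le e x g)
    intro p hp
    obtain ⟨a, ha, b, hb, rfl⟩ := exists_eq_add_X_pow_mul hp
    have h1 := hx.2 b hb
    rw [Finset.sum_eq_single g (fun g' _ hne => by simp [h g' hne]) (by simp)] at h1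
    simp only [eval_add, mul_add, Finset.sum_add_distrib]
    rw [hx.1 g a ha, (mul_eq_zero.1 h1).resolve_left (hν g), add_zero]

theorem exists_mem_groupedCode_ncard (e : ι ≃ G × Kˣ) (ν : G → L) {u v : ℕ}
    (huv : u + v < Fintype.card Kˣ) (g₀ : G) :
    ∃ x ∈ groupedCode e ν u v, x ≠ 0 ∧ Set.ncard {k | x k ≠ 0} = u + v + 1 ∧
      ∀ g, g ≠ g₀ → slice e x g = 0 := by
  classical
  obtain ⟨f, hf, hf0, hcard⟩ := exists_mem_rsCode_ncard (K := K) (L := L) huv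
  let x : ι → L := fun k => if (e k).1 = g₀ then f (e k).2 else 0
  have hx₀ : slice e x g₀ = f := by ext y; simp [x, slice]
  have hx : ∀ g, g ≠ g₀ → slice e x g = 0 := by intro g hg; ext y; simp [x, slice, hg]
  refine ⟨x, ⟨fun g => ?_, fun p hp => ?_⟩, ?_, ?_, hx⟩
  · by_cases hg : g = g₀
    · rw [hg, hx₀]
      exact rsCode_mono (Nat.le_add_right u v) hf
    · rw [hx g hg]
      exact Submodule.zero_mem _
  · rw [Finset.sum_eq_single g₀ (fun g _ hg => by simp [hx g hg]) (by simp), hx₀,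
      hf _ (X_pow_mul_mem_degreeLT hp), mul_zero]
  · intro h
    refine hf0 ?_
    rw [← hx₀, h]
    rfl
  · rw [ncard_support_eq_sum e, Finset.sum_eq_single g₀ (fun g _ hg => by simp [hx g hg])
      (by simp), hx₀, hcard]

theorem minDist_groupedCode [Nonempty G] (e : ι ≃ G × Kˣ) {ν : G → L} (hν : ∀ g, ν g ≠ 0)
    {u v : ℕ} (hvu : v ≤ u) (huv : u + v < Fintype.card Kˣ) :
    minDist (groupedCode e ν u v) = (u + v + 1 : ℕ) := by
  refine le_antisymm ?_ ?_
  · obtain ⟨x, hx, hx0, hcard, -⟩ :=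
      exists_mem_groupedCode_ncard e ν huv (Classical.arbitrary G)
    exact iInf₂_le_of_le x hx (iInf_le_of_le hx0 (by rw [hcard]))
  · refine le_iInf₂ fun x hx => le_iInf fun h0 => ?_
    exact_mod_cast lt_ncard_of_mem_groupedCode hν hvu hx h0

/-- The recovery set of a coordinate is the group that contains it. -/
theorem isLRC_groupedCode (e : ι ≃ G × Kˣ) (ν : G → L) {u : ℕ} (v : ℕ)
    (hu : u ≤ Fintype.card Kˣ) :
    IsLRC (Fintype.card Kˣ - u) (u + 1) (groupedCode e ν u v) := by
  classical
  intro i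
  refine ⟨Finset.univ.filter fun k => (e k).1 = (e i).1, by simp, ?_, ?_⟩
  · have h : (Finset.univ.filter fun k => (e k).1 = (e i).1).card ≤ Fintype.card Kˣ := by
      refine Finset.card_le_card_of_injOn (fun k => (e k).2) (fun _ _ => Finset.mem_univ _) ?_
      intro k hk k' hk' h
      simp only [Finset.coe_filter, Finset.mem_univ, true_and, Set.mem_ofPred_eq] at hk hk'
      exact e.injective (Prod.ext (hk.trans hk'.symm) h)
    omega
  · refine le_iInf₂ fun z hz => le_iInf fun h0 => ?_
    obtain ⟨x, hx, rfl⟩ := hz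
    have hs : slice e x (e i).1 ≠ 0 := by
      obtain ⟨k, hk⟩ := Function.ne_iff.1 h0
      refine Function.ne_iff.2 ⟨(e k.1).2, ?_⟩
      have hki : (e k.1).1 = (e i).1 := (Finset.mem_filter.1 k.2).2
      have : e.symm ((e i).1, (e k.1).2) = k.1 := e.symm_apply_eq.2 (Prod.ext hki.symm rfl)
      simpa [slice, this] using hk
    have h1 := lt_ncard_of_mem_rsCode (hx.1 (e i).1) hs
    refine Nat.cast_le.2 (le_trans h1 ?_)
    refine Set.ncard_le_ncard_of_injOn
      (fun y : Kˣ => ⟨e.symm ((e i).1, y), by simp⟩) (fun y hy => hy) ?_ (Set.toFinite _)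
    intro y _ y' _ h
    simpa using congrArg Subtype.val h

/-! ### The dual of the grouped code -/

/-- The encoder of the Hermitian dual of a grouped code: on the group `g` the word consists of the
values of `X * (a g + η g * X ^ u * b)`, with `deg (a g) < u` and `deg b < v`. -/
noncomputable def dualEncoder (e : ι ≃ G × Kˣ) (η : G → L) (u v : ℕ) :
    ((G → degreeLT L u) × degreeLT L v) →ₗ[L] (ι → L) where
  toFun w := fun k => algebraMap K L (e k).2 *
    ((w.1 (e k).1).1 + C (η (e k).1) * (X ^ u * w.2.1)).eval (algebraMap K L (e k).2)
  map_add' w w' := by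
    ext k
    simp only [Prod.fst_add, Prod.snd_add, Pi.add_apply, Submodule.coe_add, eval_add, eval_mul]
    ring
  map_smul' c w := by
    ext k
    simp only [Prod.smul_fst, Prod.smul_snd, Pi.smul_apply, Submodule.coe_smul, eval_add, eval_mul,
      eval_smul, smul_eq_mul, RingHom.id_apply]
    ring

omit [Fintype K] [DecidableEq K] [Fintype ι] [Fintype G] in
theorem slice_dualEncoder (e : ι ≃ G × Kˣ) (η : G → L) (u v : ℕ)
    (w : (G → degreeLT L u) × degreeLT L v) (g : G) (y : Kˣ) :
    slice e (dualEncoder e η u v w) g y = algebraMap K L y *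
      ((w.1 g).1 + C (η g) * (X ^ u * w.2.1)).eval (algebraMap K L y) := by
  simp [slice, dualEncoder]

omit [Fintype G] in
theorem add_C_mul_X_pow_mul_mem (η : G → L) (u v : ℕ) (w : (G → degreeLT L u) × degreeLT L v)
    (g : G) : (w.1 g).1 + C (η g) * (X ^ u * w.2.1) ∈ degreeLT L (u + v) := by
  refine Submodule.add_mem _ (degreeLT_mono (Nat.le_add_right u v) (w.1 g).2) ?_
  rw [← smul_eq_C_mul]
  exact Submodule.smul_mem _ _ (X_pow_mul_mem_degreeLT w.2.2)

omit [Fintype G] in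
theorem eq_zero_of_add_C_mul_X_pow_mul {η : G → L} {u v : ℕ}
    {w : (G → degreeLT L u) × degreeLT L v} {g : G} (hη : η g ≠ 0)
    (h : (w.1 g).1 + C (η g) * (X ^ u * w.2.1) = 0) : w.1 g = 0 ∧ w.2 = 0 := by
  have hb : w.2.1 = 0 := by
    ext i
    have h1 := congrArg (fun p => coeff p (i + u)) h
    have h2 := (degree_lt_iff_coeff_zero _ _).1 (mem_degreeLT.1 (w.1 g).2) (i + u) (by omega)
    simp only [coeff_add, coeff_C_mul, coeff_X_pow_mul, h2, zero_add, coeff_zero] at h1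
    simpa [hη] using h1
  rw [hb, mul_zero, mul_zero, add_zero] at h
  exact ⟨Subtype.ext h, Subtype.ext hb⟩

omit [Fintype ι] [Fintype G] in
theorem card_lt_ncard_slice_dualEncoder (e : ι ≃ G × Kˣ) (η : G → L) {u v m : ℕ}
    (w : (G → degreeLT L u) × degreeLT L v) (g : G)
    (hm : (w.1 g).1 + C (η g) * (X ^ u * w.2.1) ∈ degreeLT L m)
    (h : (w.1 g).1 + C (η g) * (X ^ u * w.2.1) ≠ 0) :
    Fintype.card Kˣ < Set.ncard {y | slice e (dualEncoder e η u v w) g y ≠ 0} + m := by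
  simp only [slice_dualEncoder]
  exact card_units_lt_ncard_add hm h

omit [Fintype K] [DecidableEq K] [Fintype ι] [Fintype G] in
theorem exists_add_C_mul_X_pow_mul_ne_zero (e : ι ≃ G × Kˣ) {η : G → L} {u v : ℕ}
    {w : (G → degreeLT L u) × degreeLT L v} (h : dualEncoder e η u v w ≠ 0) :
    ∃ g, (w.1 g).1 + C (η g) * (X ^ u * w.2.1) ≠ 0 := by
  obtain ⟨g, hg⟩ := exists_slice_ne_zero e h
  refine ⟨g, fun h0 => hg (funext fun y => ?_)⟩
  rw [slice_dualEncoder, h0, eval_zero, mul_zero, Pi.zero_apply]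

omit [Fintype ι] [Fintype G] in
theorem dualEncoder_injective [Nonempty G] (e : ι ≃ G × Kˣ) {η : G → L} (hη : ∀ g, η g ≠ 0)
    {u v : ℕ} (huv : u + v ≤ Fintype.card Kˣ) : Function.Injective (dualEncoder e η u v) := by
  rw [injective_iff_map_eq_zero]
  intro w hw
  have h : ∀ g, (w.1 g).1 + C (η g) * (X ^ u * w.2.1) = 0 := by
    intro g
    by_contra hne
    have h1 := card_lt_ncard_slice_dualEncoder e η w g (add_C_mul_X_pow_mul_mem η u v w g) hne
    have h2 : Set.ncard {y | slice e (dualEncoder e η u v w) g y ≠ 0} = 0 := by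
      rw [hw]
      simp [slice]
    omega
  have h1 := fun g => eq_zero_of_add_C_mul_X_pow_mul (hη g) (h g)
  exact Prod.ext (funext fun g => (h1 g).1) (h1 (Classical.arbitrary G)).2

omit [Fintype ι] in
theorem finrank_range_dualEncoder [Nonempty G] (e : ι ≃ G × Kˣ) {η : G → L} (hη : ∀ g, η g ≠ 0)
    {u v : ℕ} (huv : u + v ≤ Fintype.card Kˣ) :
    Module.finrank L (dualEncoder e η u v).range = Fintype.card G * u + v := by
  have h : ∀ m, Module.Finite L (degreeLT L m) := fun m =>
    (degreeLTEquiv L m).symm.finiteDimensional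
  have := h u
  have := h v
  rw [LinearMap.finrank_range_of_inj (dualEncoder_injective e hη huv), Module.finrank_prod,
    Module.finrank_pi_fintype, (degreeLTEquiv L u).finrank_eq, (degreeLTEquiv L v).finrank_eq]
  simp

theorem le_minDist_range_dualEncoder (e : ι ≃ G × Kˣ) (η : G → L) {u v d : ℕ}
    (h : u + v + d ≤ Fintype.card Kˣ + 1) :
    (d : ℕ∞) ≤ minDist (dualEncoder e η u v).range := by
  refine le_iInf₂ fun x hx => le_iInf fun h0 => ?_
  obtain ⟨w, rfl⟩ := hx
  obtain ⟨g, hg⟩ := exists_add_C_mul_X_pow_mul_ne_zero e h0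
  have h1 := card_lt_ncard_slice_dualEncoder e η w g (add_C_mul_X_pow_mul_mem η u v w g) hg
  have h2 := ncard_slice_le e (dualEncoder e η u v w) g
  exact Nat.cast_le.2 (by omega)

/-- The least weight of a codeword is attained outside the dual. In the dual, a word supported in
a single group has trivial global part, and so has larger weight than is needed. -/
theorem exists_mem_not_mem_dual [Nontrivial G] (e : ι ≃ G × Kˣ) (ν : G → L) {η : G → L}
    (hη : ∀ g, η g ≠ 0) {u v : ℕ} (huv : 2 * u + v < Fintype.card Kˣ) :
    ∃ x ∈ groupedCode e ν u v, x ∉ (dualEncoder e η u v).range ∧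
      Set.ncard {k | x k ≠ 0} = u + v + 1 := by
  obtain ⟨g₀, g₁, hne⟩ := exists_pair_ne G
  obtain ⟨x, hx, hx0, hcard, hsupp⟩ := exists_mem_groupedCode_ncard e ν
    (show u + v < Fintype.card Kˣ by omega) g₀
  refine ⟨x, hx, ?_, hcard⟩
  rintro ⟨w, rfl⟩
  have h1 : (w.1 g₁).1 + C (η g₁) * (X ^ u * w.2.1) = 0 := by
    by_contra h
    have h2 := card_lt_ncard_slice_dualEncoder e η w g₁ (add_C_mul_X_pow_mul_mem η u v w g₁) h
    rw [hsupp g₁ hne.symm] at h2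
    simp only [Pi.zero_apply, ne_eq, not_true_eq_false, Set.ofPred_false, Set.ncard_empty] at h2
    omega
  have hb := (eq_zero_of_add_C_mul_X_pow_mul (hη g₁) h1).2
  obtain ⟨g, hg⟩ := exists_add_C_mul_X_pow_mul_ne_zero e hx0
  have h2 := card_lt_ncard_slice_dualEncoder e η w g (m := u) (by simp [hb]) hg
  have h3 := ncard_slice_le e (dualEncoder e η u v w) g
  omega

omit [DecidableEq K] in
theorem eval_map_frobenius (p : L[X]) (c : K) :
    (p.map (FiniteField.frobeniusAlgHom K L : L →+* L)).eval (algebraMap K L c) =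
      p.eval (algebraMap K L c) ^ Fintype.card K := by
  have h : algebraMap K L c = (FiniteField.frobeniusAlgHom K L : L →+* L) (algebraMap K L c) :=
    ((FiniteField.frobeniusAlgHom K L).commutes c).symm
  conv_lhs => rw [h]
  rw [eval_map_apply]
  rfl

omit [DecidableEq K] in
theorem map_frobenius_map_frobenius [Fintype L] (hL : Fintype.card L = Fintype.card K ^ 2)
    (p : L[X]) : (p.map (FiniteField.frobeniusAlgHom K L : L →+* L)).map
      (FiniteField.frobeniusAlgHom K L : L →+* L) = p := by
  ext i
  rw [coeff_map, coeff_map]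
  exact pow_card_pow_card K hL _

omit [DecidableEq K] in
theorem map_frobenius_mem_degreeLT {m : ℕ} {p : L[X]} (hp : p ∈ degreeLT L m) :
    p.map (FiniteField.frobeniusAlgHom K L : L →+* L) ∈ degreeLT L m :=
  mem_degreeLT.2 (degree_map_le.trans_lt (mem_degreeLT.1 hp))

theorem sum_mul_dualEncoder_pow (e : ι ≃ G × Kˣ) (η : G → L) (u v : ℕ)
    (w : (G → degreeLT L u) × degreeLT L v) (x : ι → L) :
    ∑ k, x k * dualEncoder e η u v w k ^ Fintype.card K =
      (∑ g, ∑ y : Kˣ, slice e x g y * (algebraMap K L y *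
        ((w.1 g).1.map (FiniteField.frobeniusAlgHom K L : L →+* L)).eval (algebraMap K L y))) +
      ∑ g, η g ^ Fintype.card K * ∑ y : Kˣ, slice e x g y * (algebraMap K L y *
        (X ^ u * w.2.1.map (FiniteField.frobeniusAlgHom K L : L →+* L)).eval
          (algebraMap K L y)) := by
  rw [← Equiv.sum_comp e.symm, Fintype.sum_prod_type, ← Finset.sum_add_distrib]
  refine Finset.sum_congr rfl fun g _ => ?_
  rw [Finset.mul_sum, ← Finset.sum_add_distrib]
  refine Finset.sum_congr rfl fun y _ => ?_
  have h1 := slice_dualEncoder e η u v w g y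
  have h2 : algebraMap K L (y : K) ^ Fintype.card K = algebraMap K L y := by
    rw [← map_pow, FiniteField.pow_card]
  change x (e.symm (g, y)) * slice e (dualEncoder e η u v w) g y ^ Fintype.card K = _
  rw [h1, mul_pow, h2, eval_add, add_pow_card K, eval_mul, eval_mul, eval_mul, eval_pow, eval_C,
    eval_X, mul_pow, mul_pow, ← pow_mul, mul_comm u, pow_mul, h2, eval_map_frobenius,
    eval_map_frobenius]
  change _ = x (e.symm (g, y)) * _ + _ * (x (e.symm (g, y)) * _)
  ring

variable [Fintype L]

theorem hermitianDual_range_dualEncoder (hL : Fintype.card L = Fintype.card K ^ 2)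
    (e : ι ≃ G × Kˣ) (η : G → L) (u v : ℕ) :
    hermitianDual (Fintype.card K) (dualEncoder e η u v).range =
      groupedCode e (fun g => η g ^ Fintype.card K) u v := by
  classical
  ext x
  rw [mem_groupedCode]
  constructor
  · intro hx
    constructor
    · intro g p hp
      have h := hx _ ⟨(Pi.single g ⟨_, map_frobenius_mem_degreeLT (K := K) hp⟩, 0), rfl⟩
      rw [sum_mul_dualEncoder_pow, Finset.sum_eq_single g (fun g' _ hne => by
        simp [Pi.single_eq_of_ne hne]) (by simp)] at h
      simpa [map_frobenius_map_frobenius hL] using h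
    · intro p hp
      have h := hx _ ⟨(0, ⟨_, map_frobenius_mem_degreeLT (K := K) hp⟩), rfl⟩
      rw [sum_mul_dualEncoder_pow] at h
      simpa [map_frobenius_map_frobenius hL] using h
  · rintro ⟨h1, h2⟩ _ ⟨w, rfl⟩
    rw [sum_mul_dualEncoder_pow, h2 _ (map_frobenius_mem_degreeLT w.2.2), add_zero]
    exact Finset.sum_eq_zero fun g _ => h1 g _ (map_frobenius_mem_degreeLT (w.1 g).2)

theorem hermitianDual_groupedCode (hL : Fintype.card L = Fintype.card K ^ 2)
    (e : ι ≃ G × Kˣ) (η : G → L) (u v : ℕ) :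
    hermitianDual (Fintype.card K) (groupedCode e (fun g => η g ^ Fintype.card K) u v) =
      (dualEncoder e η u v).range := by
  rw [← hermitianDual_range_dualEncoder hL, hermitianDual_hermitianDual hL]

omit [Fintype L] [Fintype ι] in
/-- Two checks are Hermitian orthogonal because the power sums over `Kˣ` vanish for exponents below
`q - 1`, except for pairs of global checks, where the scalars are responsible. -/
theorem range_dualEncoder_le (e : ι ≃ G × Kˣ) {η : G → L} {u v : ℕ}
    (huv : 2 * u + v < Fintype.card K - 1) (hη : ∑ g, η g ^ (Fintype.card K + 1) = 0) :
    (dualEncoder e η u v).range ≤ groupedCode e (fun g => η g ^ Fintype.card K) u v := by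
  rintro _ ⟨w, rfl⟩
  rw [mem_groupedCode]
  constructor
  · intro g p hp
    simp only [slice_dualEncoder]
    exact sum_units_mul_eval_mul_eval (add_C_mul_X_pow_mul_mem η u v w g) hp (by omega)
  · intro p hp
    have h : ∀ g, η g ^ Fintype.card K * ∑ y : Kˣ, slice e (dualEncoder e η u v w) g y *
        (algebraMap K L y * (X ^ u * p).eval (algebraMap K L y)) =
        η g ^ (Fintype.card K + 1) * ∑ y : Kˣ,
          (algebraMap K L y * (X ^ u * w.2.1).eval (algebraMap K L y)) *
          (algebraMap K L y * (X ^ u * p).eval (algebraMap K L y)) := by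
      intro g
      have h1 := sum_units_mul_eval_mul_eval (K := K) (w.1 g).2
        (X_pow_mul_mem_degreeLT (u := u) hp) (by omega)
      simp only [slice_dualEncoder, eval_add, mul_add, add_mul, Finset.sum_add_distrib, h1,
        zero_add, eval_C_mul, Finset.mul_sum]
      exact Finset.sum_congr rfl fun y _ => by ring
    rw [Finset.sum_congr rfl fun g _ => h g, ← Finset.sum_mul, hη, zero_mul]

end GroupedCode

/-! ### A Vandermonde type II `τ`-OD matrix -/

section TauOD

variable {L : Type*} [Field L] {N : ℕ}

/-- The matrix with entries `ω ^ ((i + 2) j)`. The exponents `2, …, N + 1` run through all residues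
modulo `N`, and the last row has the exponent `1` modulo `N`. -/
def rootMatrix (N : ℕ) (ω : L) : Matrix (Fin N) (Fin N) L :=
  Matrix.of fun i j => ω ^ ((i.val + 2) * j.val)

theorem rootMatrix_apply (ω : L) (i j : Fin N) :
    rootMatrix N ω i j = ω ^ ((i.val + 2) * j.val) := rfl

theorem isNSC_rootMatrix {ω : L} (hω : IsPrimitiveRoot ω N) : IsNSC (rootMatrix N ω) := by
  intro s hs j hj
  rcases Nat.eq_zero_or_pos N with rfl | hN
  · obtain rfl : s = 0 := Nat.le_zero.1 hs
    exact Matrix.isUnit_iff_isUnit_det _ |>.2 (by simp)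
  have h : (rootMatrix N ω).submatrix (Fin.castLE hs) j = Matrix.of fun r c =>
      (ω ^ (j c).val) ^ 2 * (Matrix.vandermonde fun c => ω ^ (j c).val).transpose r c := by
    ext r c
    simp only [Matrix.submatrix_apply, rootMatrix_apply, Matrix.of_apply, Matrix.transpose_apply,
      Matrix.vandermonde_apply, Fin.val_castLE]
    rw [← pow_add, ← pow_mul, mul_comm, add_comm 2]
  rw [Matrix.isUnit_iff_isUnit_det, h, Matrix.det_mul_row, Matrix.det_transpose, isUnit_iff_ne_zero]
  refine mul_ne_zero (Finset.prod_ne_zero_iff.2 fun c _ =>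
    pow_ne_zero _ (pow_ne_zero _ (hω.ne_zero hN.ne'))) (Matrix.det_vandermonde_ne_zero_iff.2 ?_)
  intro c c' hcc
  exact hj.injective (Fin.ext (hω.pow_inj (j c).2 (j c').2 hcc))

open Classical in
theorem sum_pow_of_pow_eq_one {ζ : L} (hζ : ζ ^ N = 1) :
    ∑ j : Fin N, ζ ^ j.val = if ζ = 1 then (N : L) else 0 := by
  split_ifs with h
  · simp [h]
  · rw [Fin.sum_univ_eq_sum_range, geom_sum_eq h, hζ, sub_self, zero_div]

/-- The rows `i` and `k` are Hermitian non-orthogonal exactly if `i + 2 + q (k + 2)` vanishes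
modulo `N`, and for each `i` this holds for precisely one `k`. -/
theorem exists_isMonomialFor_rootMatrix {ω : L} {q : ℕ} (hω : IsPrimitiveRoot ω N) (hN : 0 < N)
    (hN0 : (N : L) ≠ 0) (hq : Nat.Coprime q N) :
    ∃ τ : Equiv.Perm (Fin N), IsMonomialFor τ
      (rootMatrix N ω * ((rootMatrix N ω).map (fun x => x ^ q)).transpose) := by
  have hω0 := hω.ne_zero hN.ne'
  have hωq := hω.pow_of_coprime q hq
  have : NeZero N := ⟨hN.ne'⟩
  have hex : ∀ i : Fin N, ∃ k : Fin N, ω ^ (i.val + 2) * (ω ^ q) ^ (k.val + 2) = 1 := by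
    intro i
    obtain ⟨k, hk, hk'⟩ := hωq.eq_pow_of_pow_eq_one (ξ := (ω ^ (i.val + 2) * (ω ^ q) ^ 2)⁻¹) (by
      rw [inv_pow, mul_pow, pow_right_comm, hω.pow_eq_one, pow_right_comm, hωq.pow_eq_one]
      simp)
    refine ⟨⟨k, hk⟩, ?_⟩
    rw [pow_add _ k, hk']
    field_simp
  choose f hf using hex
  have hinj : Function.Injective f := by
    intro i i' h
    have h1 := hf i
    rw [h, ← hf i'] at h1
    have h2 := mul_right_cancel₀ (pow_ne_zero _ (pow_ne_zero _ hω0)) h1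
    rw [pow_add, pow_add] at h2
    exact Fin.ext (hω.pow_inj i.2 i'.2 (mul_right_cancel₀ (pow_ne_zero _ hω0) h2))
  refine ⟨Equiv.ofBijective f (Finite.injective_iff_bijective.1 hinj), fun i k => ?_⟩
  have hentry : (rootMatrix N ω * ((rootMatrix N ω).map (fun x => x ^ q)).transpose) i k =
      ∑ j : Fin N, (ω ^ (i.val + 2) * (ω ^ q) ^ (k.val + 2)) ^ j.val := by
    rw [Matrix.mul_apply]
    refine Finset.sum_congr rfl fun j _ => ?_
    simp only [Matrix.transpose_apply, Matrix.map_apply, rootMatrix_apply]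
    rw [mul_pow, ← pow_mul, ← pow_mul, ← pow_mul, ← pow_mul]
    congr 2
    ring
  rw [hentry, sum_pow_of_pow_eq_one (by
    rw [mul_pow, pow_right_comm, hω.pow_eq_one, pow_right_comm, hωq.pow_eq_one]
    simp)]
  simp only [Equiv.ofBijective_apply]
  constructor
  · intro h
    have h1 : ω ^ (i.val + 2) * (ω ^ q) ^ (k.val + 2) = 1 := by
      by_contra hne
      exact h (if_neg hne)
    rw [← hf i] at h1
    have h2 := mul_left_cancel₀ (pow_ne_zero _ hω0) h1
    rw [pow_add, pow_add] at h2
    exact Fin.ext (hωq.pow_inj k.2 (f i).2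
      (mul_right_cancel₀ (pow_ne_zero _ (pow_ne_zero _ hω0)) h2))
  · rintro rfl
    rwa [if_pos (hf i)]

/-- The inverse of `rootMatrix N ω`. -/
def rootMatrixInv (N : ℕ) (ω : L) : Matrix (Fin N) (Fin N) L :=
  Matrix.of fun j i => (N : L)⁻¹ * (ω⁻¹) ^ ((i.val + 2) * j.val)

theorem rootMatrix_mul_inv {ω : L} (hω : IsPrimitiveRoot ω N) (hN0 : (N : L) ≠ 0) :
    rootMatrix N ω * rootMatrixInv N ω = 1 := by
  ext i k
  have hN : N ≠ 0 := by
    rintro rfl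
    exact i.elim0
  have hω0 := hω.ne_zero hN
  have hentry : (rootMatrix N ω * rootMatrixInv N ω) i k =
      (N : L)⁻¹ * ∑ j : Fin N, (ω ^ (i.val + 2) * (ω⁻¹) ^ (k.val + 2)) ^ j.val := by
    rw [Matrix.mul_apply, Finset.mul_sum]
    refine Finset.sum_congr rfl fun j _ => ?_
    simp only [rootMatrixInv, rootMatrix_apply, Matrix.of_apply]
    rw [mul_pow, ← pow_mul, ← pow_mul]
    ring
  have h1 : ω ^ (i.val + 2) * (ω⁻¹) ^ (k.val + 2) = 1 ↔ i = k := by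
    rw [inv_pow, mul_inv_eq_one₀ (pow_ne_zero _ hω0), pow_add, pow_add]
    refine ⟨fun h => ?_, fun h => by rw [h]⟩
    exact Fin.ext (hω.pow_inj i.2 k.2 (mul_right_cancel₀ (pow_ne_zero _ hω0) h))
  rw [hentry, sum_pow_of_pow_eq_one (by
    rw [mul_pow, pow_right_comm, hω.pow_eq_one, pow_right_comm, inv_pow, hω.pow_eq_one]
    simp), Matrix.one_apply]
  simp only [h1]
  split_ifs
  · exact inv_mul_cancel₀ hN0
  · exact mul_zero _

end TauOD

/-! ### The matrix-product code -/

theorem sum_mul_sum_of_mul_eq_one {F : Type*} [Field F] {N : ℕ} {A B : Matrix (Fin N) (Fin N) F}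
    (h : A * B = 1) (c : Fin N → F) (i : Fin N) : ∑ j, B j i * ∑ i', A i' j * c i' = c i := by
  have h1 := congrFun (Matrix.vecMul_vecMul c A B) i
  rw [h, Matrix.vecMul_one] at h1
  rw [← h1]
  simp only [Matrix.vecMul, dotProduct, mul_comm]

theorem mem_mpCode_iff_of_mul_eq_one {F ι : Type*} [Field F] {N : ℕ}
    (C : Fin N → Submodule F (ι → F)) {A B : Matrix (Fin N) (Fin N) F} (h : A * B = 1)
    (x : Fin N × ι → F) :
    x ∈ mpCode C A ↔ ∀ i, (fun k => ∑ j, B j i * x (j, k)) ∈ C i := by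
  constructor
  · rintro ⟨c, hc, hx⟩ i
    simp only [hx, sum_mul_sum_of_mul_eq_one h]
    exact hc i
  · intro hx
    exact ⟨_, hx, fun j k => (sum_mul_sum_of_mul_eq_one (mul_eq_one_comm.1 h)
      (fun j => x (j, k)) j).symm⟩

section MatrixProduct

open Polynomial

variable {K L κ G : Type*} [Field K] [Fintype K] [DecidableEq K] [Field L] [Algebra K L]
  [Fintype G] {N : ℕ}

/-- The grouping of the coordinates of a concatenation of `N` blocks: each group of each block. -/
def blockEquiv (N : ℕ) (e : κ ≃ G × Kˣ) : Fin N × κ ≃ (Fin N × G) × Kˣ :=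
  (Equiv.prodCongr (Equiv.refl _) e).trans (Equiv.prodAssoc _ _ _).symm

/-- The constituent codes: those for the rows before the last have only the checks on single
groups, the last one has in addition `v` global checks. -/
def constituentCode (e : κ ≃ G × Kˣ) (u v : ℕ) (i : Fin N) : Submodule L (κ → L) :=
  groupedCode e 1 u (if i.val + 1 = N then v else 0)

omit [Fintype K] [DecidableEq K] [Field L] [Algebra K L] [Fintype G] in
theorem slice_blockEquiv (e : κ ≃ G × Kˣ) (x : Fin N × κ → L) (j : Fin N) (b : G) :
    slice (blockEquiv N e) x (j, b) = slice e (fun k => x (j, k)) b := rfl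

/-- The last row of the matrix has the exponent `1` modulo `N`, so the global checks of the last
constituent become checks on the whole word, with the scalars `ω ^ (-j)`. -/
theorem mpCode_rootMatrix {ω : L} (hω : IsPrimitiveRoot ω N) (hN : 0 < N) (hN0 : (N : L) ≠ 0)
    (e : κ ≃ G × Kˣ) (u v : ℕ) :
    mpCode (constituentCode e u v) (rootMatrix N ω) =
      groupedCode (blockEquiv N e) (fun g => (ω⁻¹) ^ g.1.val) u v := by
  have hmul := rootMatrix_mul_inv hω hN0
  ext x
  have hglobal : ∀ (i : Fin N) (p : L[X]), i.val + 1 = N →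
      ∑ b, (1 : G → L) b * ∑ y : Kˣ,
        slice e (fun k => ∑ j, rootMatrixInv N ω j i * x (j, k)) b y *
          (algebraMap K L y * (X ^ u * p).eval (algebraMap K L y)) =
      (N : L)⁻¹ * ∑ g : Fin N × G, (ω⁻¹) ^ g.1.val * ∑ y : Kˣ, slice (blockEquiv N e) x g y *
          (algebraMap K L y * (X ^ u * p).eval (algebraMap K L y)) := by
    intro i p hi
    have hB : ∀ j, rootMatrixInv N ω j i = (N : L)⁻¹ * (ω⁻¹) ^ j.val := by
      intro j
      rw [rootMatrixInv, Matrix.of_apply, show (i.val + 2) * j.val = N * j.val + j.val by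
        rw [show i.val + 2 = N + 1 by omega]; ring, pow_add, pow_mul, inv_pow ω N, hω.pow_eq_one,
        inv_one, one_pow, one_mul]
    rw [Fintype.sum_prod_type, Finset.sum_comm, Finset.mul_sum]
    refine Finset.sum_congr rfl fun b _ => ?_
    simp only [slice, hB, Pi.one_apply, one_mul, Finset.sum_mul]
    rw [Finset.sum_comm, Finset.mul_sum]
    refine Finset.sum_congr rfl fun j _ => ?_
    rw [Finset.mul_sum, Finset.mul_sum]
    refine Finset.sum_congr rfl fun y _ => ?_
    change _ = (N : L)⁻¹ * (_ * (x (j, e.symm (b, y)) * _))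
    ring
  constructor
  · intro hx
    refine ⟨?_, fun p hp => ?_⟩
    · obtain ⟨c, hc, hxc⟩ := hx
      rintro ⟨j, b⟩
      have : slice (blockEquiv N e) x (j, b) =
          ∑ i, rootMatrix N ω i j • slice e (c i) b := by
        ext y
        rw [slice_blockEquiv, Finset.sum_apply]
        exact hxc j _
      rw [this]
      exact Submodule.sum_mem _ fun i _ => Submodule.smul_mem _ _ ((hc i).1 b)
    · have hlast : (⟨N - 1, by omega⟩ : Fin N).val + 1 = N := Nat.sub_add_cancel hN
      have h1 := ((mem_mpCode_iff_of_mul_eq_one _ hmul x).1 hx ⟨N - 1, by omega⟩).2 p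
        (by rwa [if_pos hlast])
      rw [hglobal _ _ hlast] at h1
      exact (mul_eq_zero.1 h1).resolve_left (inv_ne_zero hN0)
  · intro hx
    rw [mem_mpCode_iff_of_mul_eq_one _ hmul]
    intro i
    refine ⟨fun b => ?_, fun p hp => ?_⟩
    · have : slice e (fun k => ∑ j, rootMatrixInv N ω j i * x (j, k)) b =
          ∑ j, rootMatrixInv N ω j i • slice (blockEquiv N e) x (j, b) := by
        ext y
        rw [Finset.sum_apply]
        rfl
      rw [this]
      exact Submodule.sum_mem _ fun j _ => Submodule.smul_mem _ _ (hx.1 (j, b))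
    · split_ifs at hp with hi
      · rw [hglobal i p hi, hx.2 p hp, mul_zero]
      · have h0 : p = 0 := by
          rw [mem_degreeLT] at hp
          exact degree_eq_bot.1 (Nat.WithBot.lt_zero_iff.1 (by simpa using hp))
        simp [h0]

end MatrixProduct

/-! ### Roots of unity in a finite field and the rounding in the Singleton-like bound -/

theorem exists_isPrimitiveRoot_of_dvd {L : Type*} [Field L] [Fintype L] {N : ℕ}
    (hN : N ∣ Fintype.card L - 1) : ∃ ω : L, IsPrimitiveRoot ω N := by
  classical
  obtain ⟨g, hg⟩ := IsCyclic.exists_generator (α := Lˣ)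
  obtain ⟨m, hm⟩ := hN
  have hord : orderOf g = N * m := by
    rw [orderOf_eq_card_of_forall_mem_zpowers hg, Nat.card_eq_fintype_card, Fintype.card_units, hm]
  have h1 : IsPrimitiveRoot g (N * m) := hord ▸ IsPrimitiveRoot.orderOf g
  have h2 := h1.pow (hord ▸ orderOf_pos g) (mul_comm N m)
  exact ⟨_, IsPrimitiveRoot.coe_units_iff.2 h2⟩

theorem natCast_ne_zero_of_dvd {L : Type*} [Field L] [Fintype L] {N : ℕ}
    (hN : N ∣ Fintype.card L - 1) : (N : L) ≠ 0 := by
  obtain ⟨m, hm⟩ := hN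
  intro h
  have h1 : ((N * m + 1 : ℕ) : L) = 0 := by
    rw [← hm, Nat.sub_add_cancel Fintype.card_pos, FiniteField.cast_card_eq_zero]
  rw [Nat.cast_add, Nat.cast_mul, h, zero_mul, zero_add, Nat.cast_one] at h1
  exact one_ne_zero h1

theorem ceil_div_eq {m r v : ℕ} (hv : v < r) {s : ℚ} (hs : s = 2 * (m * r - v)) :
    ⌈s / (2 * r)⌉ = m := by
  have hr : (0 : ℚ) < r := by exact_mod_cast (Nat.zero_le v).trans_lt hv
  have hv' : (v : ℚ) < r := by exact_mod_cast hv
  have hv0 : (0 : ℚ) ≤ v := Nat.cast_nonneg v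
  rw [Int.ceil_eq_iff, hs]
  constructor
  · rw [lt_div_iff₀ (by positivity)]
    push_cast
    nlinarith
  · rw [div_le_iff₀ (by positivity)]
    push_cast
    nlinarith

/-! ### The optimal quantum locally recoverable codes -/

theorem theorem8 {K L : Type*} [Field K] [Fintype K] [Field L] [Fintype L] [Algebra K L]
    (q N u v t : ℕ) (hK : Fintype.card K = q) (hL : Fintype.card L = q ^ 2) (hq : 5 ≤ q)
    (hN : N ∣ q ^ 2 - 1) (hN' : ¬ N ∣ q + 1) (hu : 0 < u) (ht : 0 < t)
    (hvu : v ≤ u) (huv : 2 * u + v ≤ q - 2) :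
    ∃ (τ : Equiv.Perm (Fin N)) (A : Matrix (Fin N) (Fin N) L)
      (C : Fin N → Submodule L (Fin (t * (q - 1)) → L))
      (Q : Submodule ℂ ((Fin N × Fin (t * (q - 1)) → K) → ℂ)),
      IsTypeIITauOD q τ A ∧
      IsOptimalQuantumLRC (q - 1 - u) (u + 1)
        (N * t * (q - 1)) (N * t * (q - 1) - 2 * N * t * u - 2 * v) (u + v + 1)
        (mpCode C A) Q := by
  classical
  subst hK
  set q := Fintype.card K with hqdef
  have hNL : N ∣ Fintype.card L - 1 := hL ▸ hN
  obtain ⟨ω, hω⟩ := exists_isPrimitiveRoot_of_dvd hNL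
  have hN0 := natCast_ne_zero_of_dvd hNL
  have hNpos : 0 < N := Nat.pos_of_ne_zero fun h => hN0 (by rw [h, Nat.cast_zero])
  have hN2 : 2 ≤ N := by
    by_contra hlt
    obtain rfl : N = 1 := by omega
    exact hN' (one_dvd _)
  have hω0 := hω.ne_zero hNpos.ne'
  have hcop : Nat.Coprime q N := by
    obtain ⟨m, hm⟩ := hN
    have h1 : q ^ 2 = N * m + 1 := by
      rw [← hm, Nat.sub_add_cancel (Nat.one_le_pow _ _ (by omega))]
    refine Nat.Coprime.coprime_dvd_left (dvd_pow_self q two_ne_zero) ?_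
    rw [h1]
    simp
  obtain ⟨τ, hτ⟩ := exists_isMonomialFor_rootMatrix hω hNpos hN0 hcop
  have hunits : Fintype.card Kˣ = q - 1 := Fintype.card_units K
  let e : Fin (t * (q - 1)) ≃ Fin t × Kˣ := Fintype.equivOfCardEq (by simp [hunits])
  have : Nonempty (Fin N × Fin t) := ⟨⟨0, hNpos⟩, ⟨0, ht⟩⟩
  have : Nontrivial (Fin N × Fin t) := ⟨(⟨0, hNpos⟩, ⟨0, ht⟩), (⟨1, hN2⟩, ⟨0, ht⟩), by simp⟩
  -- The scalars of the global checks are `η ^ q = ω ^ (-j)`.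
  let η : Fin N × Fin t → L := fun g => ((ω⁻¹) ^ g.1.val) ^ q
  have hη0 : ∀ g, η g ≠ 0 := fun g => pow_ne_zero _ (pow_ne_zero _ (inv_ne_zero hω0))
  have hηq : (fun g => η g ^ q) = fun g : Fin N × Fin t => (ω⁻¹) ^ g.1.val :=
    funext fun g => pow_card_pow_card K hL _
  have hηsum : ∑ g, η g ^ (q + 1) = 0 := by
    have hω' := (hω.inv).pow_of_coprime q hcop
    have hne : ((ω⁻¹) ^ q) ^ (q + 1) ≠ 1 := fun h => hN' (hω'.dvd_of_pow_eq_one _ h)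
    rw [Fintype.sum_prod_type, Finset.sum_comm]
    refine Finset.sum_eq_zero fun b _ => ?_
    rw [← (sum_pow_of_pow_eq_one (N := N) (ζ := ((ω⁻¹) ^ q) ^ (q + 1)) (by
      rw [pow_right_comm, hω'.pow_eq_one, one_pow])).trans (if_neg hne)]
    refine Finset.sum_congr rfl fun j _ => ?_
    simp only [η, ← pow_mul]
    congr 1
    ring
  have hcode : mpCode (constituentCode e u v) (rootMatrix N ω) =
      groupedCode (blockEquiv N e) (fun g => η g ^ q) u v := by
    rw [mpCode_rootMatrix hω hNpos hN0, hηq]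
  have hνne : ∀ g, η g ^ q ≠ 0 := fun g => pow_ne_zero _ (hη0 g)
  have hdualeq := hermitianDual_groupedCode hL (blockEquiv N e) η u v
  -- `q - 1 = 2 u + v + 1 + w` and `k = N t (v + 1 + w) - 2 v`.
  obtain ⟨w, hw⟩ : ∃ w, q - 1 = 2 * u + v + 1 + w := ⟨q - 1 - (2 * u + v + 1), by omega⟩
  have hNt : 2 ≤ N * t := le_trans hN2 (Nat.le_mul_of_pos_right N ht)
  obtain ⟨k, hk⟩ : ∃ k, N * t * (v + 1 + w) = k + 2 * v := by
    refine ⟨N * t * (v + 1 + w) - 2 * v, (Nat.sub_add_cancel ?_).symm⟩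
    exact Nat.mul_le_mul hNt (by omega)
  have hnk : N * t * (q - 1) = k + 2 * v + 2 * N * t * u := by
    rw [← hk, hw]
    ring
  have hk' : N * t * (q - 1) - 2 * N * t * u - 2 * v = k := by omega
  rw [hk']
  have hcard : Fintype.card (Fin N × Fin (t * (q - 1))) = N * t * (q - 1) := by
    simp [mul_assoc]
  have hle : hermitianDual q (groupedCode (blockEquiv N e) (fun g => η g ^ q) u v) ≤
      groupedCode (blockEquiv N e) (fun g => η g ^ q) u v := by
    rw [hdualeq]
    exact range_dualEncoder_le _ (by omega) hηsum
  have hdim : 2 * Module.finrank L (groupedCode (blockEquiv N e) (fun g => η g ^ q) u v) =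
      N * t * (q - 1) + k := by
    have h1 := finrank_hermitianDual K hL (groupedCode (blockEquiv N e) (fun g => η g ^ q) u v)
    rw [hdualeq, finrank_range_dualEncoder _ hη0 (by omega), hcard, Fintype.card_prod,
      Fintype.card_fin, Fintype.card_fin] at h1
    have h2 : 2 * N * t * u = 2 * (N * t * u) := by ring
    omega
  have hdist := minDist_groupedCode (blockEquiv N e) hνne hvu
    (show u + v < Fintype.card Kˣ by omega)
  obtain ⟨x, hx, hxD, hxw⟩ := exists_mem_not_mem_dual (blockEquiv N e) (fun g => η g ^ q) hη0
    (show 2 * u + v < Fintype.card Kˣ by omega)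
  rw [← hdualeq] at hxD
  obtain ⟨Q, hQ, hQ'⟩ := exists_quantumCode hL _ hcard hle hdim hdist ⟨x, hx, hxD, hxw⟩
  refine ⟨τ, rootMatrix N ω, constituentCode e u v, Q, ⟨isNSC_rootMatrix hω, hτ⟩, ?_⟩
  rw [hcode]
  refine ⟨hle, hdim, hdist, ?_, ?_, ?_, hQ, hQ'⟩
  · have h1 := isLRC_groupedCode (blockEquiv N e) (fun g => η g ^ q) (u := u) v (by omega)
    rwa [show Fintype.card Kˣ - u = q - 1 - u by omega] at h1
  · rw [← hqdef, hdualeq]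
    exact le_minDist_range_dualEncoder _ _ (by omega)
  · have hr : q - 1 - u = u + v + 1 + w := by omega
    rw [hr, ceil_div_eq (m := N * t) (v := v) (by omega)]
    · have h1 : ((N * t * (q - 1) : ℕ) : ℤ) = k + 2 * v + 2 * N * t * u := by exact_mod_cast hnk
      rw [h1]
      push_cast
      ring
    · have h1 : ((N * t * (q - 1) : ℕ) : ℚ) = k + 2 * v + 2 * N * t * u := by exact_mod_cast hnk
      have h2 : ((N * t * (v + 1 + w) : ℕ) : ℚ) = k + 2 * v := by exact_mod_cast hk
      rw [h1]
      push_cast at h2 ⊢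
      linear_combination (-2) * h2
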